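/- Let $X,Y\subset\mathbb{R}^n$ be open and let $c:X\times Y\to\mathbb{R}$ be a cost satisfying (C0) $c\in C^4(X\times Y)$ with $\|c\|_{C^4(X\times Y)}<\infty$; (C1) for every $x\in X$ the map $Y\ni y\mapsto -D_xc(x,y)\in\mathbb{R}^n$ is injective. For $x\in X$, $y\in Y$, $p\in\mathbb{R}^n$ write $c\text{-}\exp_x(p)=y$ if and only if $p=-D_xc(x,y)$. A function $u:X\to\mathbb{R}$ is called $c$-convex if $u(x)=\sup_{y\in Y}[u^c(y)-c(x,y)]$ for all $x\in X$, where $u^c(y)=\inf_{x\in X}[u(x)+c(x,y)]\in\mathbb{R}\cup\{-\infty\}$. An optimal transport map sending $f$ onto $g$ is a measurable map $T:X\to Y$, defined $f\,dx$-a.e., with $T_\#(f\,dx)=g\,dy$, which minimizes $\int c(x,S(x))f(x)\,dx$ among all such maps $S$. Let $f$ and $g$ be probability densities on $\mathbb{R}^n$ vanishing outside $X$ and outside $Y$, respectively. Then there is a $c$-convex function $u:X\to\mathbb{R}$ such that 1. for $f\,dx$-a.e. $x\in X$, $u$ is differentiable at $x$ and $T_u(x):=c\text{-}\exp_x(\nabla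 u(x))\in Y$ is defined (let $D_u\subset X$ be the set of these points $x$); 2. $T_u$ is an optimal transport map sending $f$ onto $g$, and every optimal transport map sending $f$ onto $g$ coincides with $T_u$ $f\,dx$-a.e. Assume in addition (C2) for every $y\in Y$ the map $X\ni x\mapsto -D_yc(x,y)\in\mathbb{R}^n$ is injective. Then, for the same $u$: 3. $T_u$ is injective on a set of full $f\,dx$-measure; 4. for $f\,dx$-a.e. $x$: if $T_u:D_u\to Y$ is differentiable at $x$, then $$|\det\nabla T_u(x)|=\frac{f(x)}{g(T_u(x))};$$ and if $\det D_{xy}c(x,T_u(x))\neq0$, then $T_u:D_u\to Y$ is differentiable at $x$. In particular, if $\det D_{xy}c\ne0$ on $X\times Y$, the Jacobian equation holds $f\,dx$-a.e.; 5. there is a unique (up to $g\,dy$-null sets) optimal transport map $S:Y\to X$ sending $g$ onto $f$, for the cost $(y,x)\mapsto c(x,y)$, and $S(T_u(x))=x$ for $f\,dx$-a.e. $x$, $T_u(S(y))=y$ for $g\,dy$-a.e. $y$. -/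

import Mathlib

open MeasureTheory Set

/-- Partial gradient `D_x c(x, y)` in the first variable. -/
noncomputable def gradX {n : ℕ}
    (c : EuclideanSpace ℝ (Fin n) × EuclideanSpace ℝ (Fin n) → ℝ)
    (x y : EuclideanSpace ℝ (Fin n)) : EuclideanSpace ℝ (Fin n) :=
  gradient (fun x' => c (x', y)) x

/-- Partial gradient `D_y c(x, y)` in the second variable. -/
noncomputable def gradY {n : ℕ}
    (c : EuclideanSpace ℝ (Fin n) × EuclideanSpace ℝ (Fin n) → ℝ)
    (x y : EuclideanSpace ℝ (Fin n)) : EuclideanSpace ℝ (Fin n) :=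
  gradient (fun y' => c (x, y')) y

/-- The mixed second derivative `D_{xy} c(x, y)`, as the derivative of `y ↦ D_x c(x, y)`. -/
noncomputable def mixedHessian {n : ℕ}
    (c : EuclideanSpace ℝ (Fin n) × EuclideanSpace ℝ (Fin n) → ℝ)
    (x y : EuclideanSpace ℝ (Fin n)) :
    EuclideanSpace ℝ (Fin n) →L[ℝ] EuclideanSpace ℝ (Fin n) :=
  fderiv ℝ (fun y' => gradX c x y') y

/-- Condition (C0): `c` is of class `C⁴` on `X × Y`, and its `C⁴` norm there is finite. -/
def CondC0 {n : ℕ} (X Y : Set (EuclideanSpace ℝ (Fin n)))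
    (c : EuclideanSpace ℝ (Fin n) × EuclideanSpace ℝ (Fin n) → ℝ) : Prop :=
  ContDiffOn ℝ 4 c (X ×ˢ Y) ∧
    ∃ M : ℝ, ∀ k : ℕ, k ≤ 4 → ∀ z ∈ X ×ˢ Y, ‖iteratedFDeriv ℝ k c z‖ ≤ M

/-- Condition (C1): for each `x ∈ X`, the map `y ↦ -D_x c(x, y)` is injective on `Y`. -/
def CondC1 {n : ℕ} (X Y : Set (EuclideanSpace ℝ (Fin n)))
    (c : EuclideanSpace ℝ (Fin n) × EuclideanSpace ℝ (Fin n) → ℝ) : Prop :=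
  ∀ x ∈ X, InjOn (fun y => -gradX c x y) Y

/-- Condition (C2): for each `y ∈ Y`, the map `x ↦ -D_y c(x, y)` is injective on `X`. -/
def CondC2 {n : ℕ} (X Y : Set (EuclideanSpace ℝ (Fin n)))
    (c : EuclideanSpace ℝ (Fin n) × EuclideanSpace ℝ (Fin n) → ℝ) : Prop :=
  ∀ y ∈ Y, InjOn (fun x => -gradY c x y) X

/-- `ψᶜ(y) = inf_{x ∈ X} [ψ(x) + c(x, y)]`. -/
noncomputable def cTransform {n : ℕ} (X : Set (EuclideanSpace ℝ (Fin n)))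
    (c : EuclideanSpace ℝ (Fin n) × EuclideanSpace ℝ (Fin n) → ℝ)
    (ψ : EuclideanSpace ℝ (Fin n) → EReal) (y : EuclideanSpace ℝ (Fin n)) : EReal :=
  ⨅ x ∈ X, (ψ x + (c (x, y) : EReal))

/-- `ψ : X → ℝ ∪ {+∞}` is `c`-convex: `ψ(x) = sup_{y ∈ Y} [ψᶜ(y) - c(x, y)]` for all `x ∈ X`.
The values of `ψ` outside `X` play no role. -/
def IsCConvex {n : ℕ} (X Y : Set (EuclideanSpace ℝ (Fin n)))
    (c : EuclideanSpace ℝ (Fin n) × EuclideanSpace ℝ (Fin n) → ℝ)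
    (ψ : EuclideanSpace ℝ (Fin n) → EReal) : Prop :=
  (∀ x ∈ X, ψ x ≠ ⊥) ∧
    ∀ x ∈ X, ψ x = ⨆ y ∈ Y, (cTransform X c ψ y - (c (x, y) : EReal))

/-- The `c`-exponential map: `cExp c Y x p` is the point `y ∈ Y` with `p = -D_x c(x, y)`
(unique under (C1)); an arbitrary value if there is no such point. -/
noncomputable def cExp {n : ℕ}
    (c : EuclideanSpace ℝ (Fin n) × EuclideanSpace ℝ (Fin n) → ℝ)
    (Y : Set (EuclideanSpace ℝ (Fin n))) (x p : EuclideanSpace ℝ (Fin n)) :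
    EuclideanSpace ℝ (Fin n) :=
  Classical.epsilon fun y => y ∈ Y ∧ p = -gradX c x y

/-- The map `T_u(x) = c-exp_x(∇u(x))`. -/
noncomputable def cMap {n : ℕ}
    (c : EuclideanSpace ℝ (Fin n) × EuclideanSpace ℝ (Fin n) → ℝ)
    (Y : Set (EuclideanSpace ℝ (Fin n))) (u : EuclideanSpace ℝ (Fin n) → ℝ)
    (x : EuclideanSpace ℝ (Fin n)) : EuclideanSpace ℝ (Fin n) :=
  cExp c Y x (gradient u x)

/-- The set of points of `X` at which the expression `c-exp_x(∇u(x))` is meaningful: `u` is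
differentiable at `x` and `∇u(x)` lies in the domain of `c-exp_x`. -/
def cMapDomain {n : ℕ} (X Y : Set (EuclideanSpace ℝ (Fin n)))
    (c : EuclideanSpace ℝ (Fin n) × EuclideanSpace ℝ (Fin n) → ℝ)
    (u : EuclideanSpace ℝ (Fin n) → ℝ) : Set (EuclideanSpace ℝ (Fin n)) :=
  {x | x ∈ X ∧ DifferentiableAt ℝ u x ∧ ∃ y ∈ Y, gradient u x = -gradX c x y}

/-- `f` is a probability density supported on `X`. -/
structure IsProbDensityOn {n : ℕ} (X : Set (EuclideanSpace ℝ (Fin n)))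
    (f : EuclideanSpace ℝ (Fin n) → ℝ) : Prop where
  nonneg : ∀ x, 0 ≤ f x
  integrable : Integrable f
  integral_eq_one : ∫ x, f x = 1
  eq_zero : ∀ x, x ∉ X → f x = 0

/-- The measure `f dx`. -/
noncomputable def densityMeasure {n : ℕ} (f : EuclideanSpace ℝ (Fin n) → ℝ) :
    Measure (EuclideanSpace ℝ (Fin n)) :=
  volume.withDensity fun x => ENNReal.ofReal (f x)

/-- `S` is a transport map from `μ` to `ν` with values in `Y`: it is measurable and `S_# μ = ν`.
Transport maps are maps defined up to `μ`-null sets. -/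
structure IsTransportMap {n : ℕ} (Y : Set (EuclideanSpace ℝ (Fin n)))
    (μ ν : Measure (EuclideanSpace ℝ (Fin n)))
    (S : EuclideanSpace ℝ (Fin n) → EuclideanSpace ℝ (Fin n)) : Prop where
  aemeasurable : AEMeasurable S μ
  mem_target : ∀ᵐ x ∂μ, S x ∈ Y
  map_eq : μ.map S = ν

/-- `T` is an optimal transport map from `μ` to `ν` for the (bounded) cost `c`. -/
def IsOptimalMap {n : ℕ} (Y : Set (EuclideanSpace ℝ (Fin n)))
    (c : EuclideanSpace ℝ (Fin n) × EuclideanSpace ℝ (Fin n) → ℝ)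
    (μ ν : Measure (EuclideanSpace ℝ (Fin n)))
    (T : EuclideanSpace ℝ (Fin n) → EuclideanSpace ℝ (Fin n)) : Prop :=
  IsTransportMap Y μ ν T ∧
    ∀ S, IsTransportMap Y μ ν S → ∫ x, c (x, T x) ∂μ ≤ ∫ x, c (x, S x) ∂μ

/-!
The potential `u` comes from Kantorovich duality. By Prokhorov's theorem there is an optimal coupling
`π` of the two densities (`exists_optimal_coupling`); its support is `c`-cyclically monotone, since
exchanging small portions of mass along a chain would otherwise lower the cost
(`isCyclicallyMonotone_support`). Rockafellar's supremum over chains then gives bounded potentials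
`u` and `φ`, conjugate to each other, such that `u x + c (x, y) = φ y` for `π`-almost every `(x, y)`
(`exists_coupling_potentials`).

As a supremum of functions with uniformly bounded second derivatives, `u` is locally touched from
below by paraboloids of fixed opening. Hence it is locally Lipschitz, differentiable almost
everywhere, and at a contact point `(x, y)` one has `∇u(x) = -D_x c(x, y)`. By (C1) the coupling is
carried by the graph of `T_u`. The nonnegative function `u x + c (x, y) - φ y` measures how far a
transport map is from being optimal, and it vanishes almost everywhere only for `T_u`
(`IsConjugatePair.isOptimalMap_cMap`). All of this is symmetric in the two variables: under (C2) it
applies to `-φ` and `-u` and the swapped coupling, whose graph map is the inverse of `T_u`.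

Differentiability of `T_u` combines Alexandrov's theorem with the implicit function theorem for
`p + D_x c(x, y) = 0` (`differentiableWithinAt_cMap`). Alexandrov's theorem is proved here by the
remark that `(2K+1) id + ∇u` has a `1`-Lipschitz inverse, to which Rademacher's theorem and Sard's
lemma apply (`HasLowerParaboloids.ae_hasFDerivWithinAt_gradient`). The Jacobian equation needs only
that `T_u` transports `f` to `g` and is essentially injective: the set where a map is differentiable
relative to some set is a countable union of pieces on which the map is Lipschitz, and there the
change of variables formula applies to a Lipschitz extension (`ae_jacobian_of_map_withDensity`).
-/

/-! ### Optimal couplings and cyclical monotonicity -/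

section Kantorovich

open Filter Topology
open scoped BoundedContinuousFunction ENNReal

/-- A set `Γ` is `c`-cyclically monotone: along every closed chain
`p 0, p 1, …, p n = p 0` of points of `Γ`, reassigning to each second component the first
component of the next point does not lower the total cost. -/
def IsCyclicallyMonotone {α β : Type*} (c : α × β → ℝ) (Γ : Set (α × β)) : Prop :=
  ∀ (n : ℕ) (p : ℕ → α × β), (∀ i, p i ∈ Γ) → p n = p 0 →
    ∑ i ∈ Finset.range n, c (p i) ≤ ∑ i ∈ Finset.range n, c ((p (i + 1)).1, (p i).2)

section Existence

variable {α β : Type*} [TopologicalSpace α] [TopologicalSpace β] [PolishSpace α] [PolishSpace β]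
  [MeasurableSpace α] [MeasurableSpace β] [BorelSpace α] [BorelSpace β]

/-- Existence of an optimal plan: the set of couplings is compact by Prokhorov's theorem. -/
theorem exists_optimal_coupling (c : α × β →ᵇ ℝ) (μ : Measure α) (ν : Measure β)
    [IsProbabilityMeasure μ] [IsProbabilityMeasure ν] :
    ∃ π : Measure (α × β), IsProbabilityMeasure π ∧ π.fst = μ ∧ π.snd = ν ∧
      ∀ ρ : Measure (α × β), IsProbabilityMeasure ρ → ρ.fst = μ → ρ.snd = ν →
        ∫ z, c z ∂π ≤ ∫ z, c z ∂ρ := by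
  let S : Set (ProbabilityMeasure (α × β)) :=
    {π | (π : Measure (α × β)).fst = μ ∧ (π : Measure (α × β)).snd = ν}
  let μ' : ProbabilityMeasure α := ⟨μ, inferInstance⟩
  let ν' : ProbabilityMeasure β := ⟨ν, inferInstance⟩
  have hfst : Continuous fun π : ProbabilityMeasure (α × β) =>
      π.map (f := Prod.fst) measurable_fst.aemeasurable :=
    ProbabilityMeasure.continuous_map continuous_fst
  have hsnd : Continuous fun π : ProbabilityMeasure (α × β) =>
      π.map (f := Prod.snd) measurable_snd.aemeasurable :=
    ProbabilityMeasure.continuous_map continuous_snd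
  have hSc : IsClosed S := by
    have : S = (fun π : ProbabilityMeasure (α × β) =>
          π.map (f := Prod.fst) measurable_fst.aemeasurable) ⁻¹' {μ'} ∩
        (fun π : ProbabilityMeasure (α × β) =>
          π.map (f := Prod.snd) measurable_snd.aemeasurable) ⁻¹' {ν'} := by
      ext π
      rw [mem_inter_iff, mem_preimage, mem_preimage, mem_singleton_iff, mem_singleton_iff,
        ← ProbabilityMeasure.toMeasure_injective.eq_iff,
        ← ProbabilityMeasure.toMeasure_injective.eq_iff]
      rfl
    rw [this]
    exact (isClosed_singleton.preimage hfst).inter (isClosed_singleton.preimage hsnd)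
  have hSt : IsTightMeasureSet {((π : ProbabilityMeasure (α × β)) : Measure (α × β)) | π ∈ S} := by
    refine IsTightMeasureSet.prodMk ?_ ?_
    · refine (isTightMeasureSet_singleton (μ := μ)).subset ?_
      rintro _ ⟨_, ⟨π, hπ, rfl⟩, rfl⟩
      exact hπ.1
    · refine (isTightMeasureSet_singleton (μ := ν)).subset ?_
      rintro _ ⟨_, ⟨π, hπ, rfl⟩, rfl⟩
      exact hπ.2
  have hcomp : IsCompact S := by
    have := isCompact_closure_of_isTightMeasureSet hSt
    rwa [hSc.closure_eq] at this
  have hne : S.Nonempty := ⟨⟨μ.prod ν, inferInstance⟩, Measure.fst_prod, Measure.snd_prod⟩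
  obtain ⟨π, hπ, hmin⟩ := hcomp.exists_isMinOn hne
    (ProbabilityMeasure.continuous_integral_boundedContinuousFunction c).continuousOn
  refine ⟨π, inferInstance, hπ.1, hπ.2, fun ρ hρ h1 h2 => ?_⟩
  exact hmin (show (⟨ρ, hρ⟩ : ProbabilityMeasure (α × β)) ∈ S from ⟨h1, h2⟩)

end Existence

section Perturbation

variable {α β : Type*} [MeasurableSpace α] [MeasurableSpace β]

/-- Exchanging the marginals of finitely many probability measures whose sum is dominated by an
optimal plan cannot lower the cost. -/
theorem sum_integral_le_of_optimal {c : α × β → ℝ} (hc : Measurable c) {M : ℝ}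
    (hM : ∀ z, |c z| ≤ M) {π : Measure (α × β)} [IsProbabilityMeasure π]
    (hopt : ∀ ρ : Measure (α × β), IsProbabilityMeasure ρ → ρ.fst = π.fst → ρ.snd = π.snd →
        ∫ z, c z ∂π ≤ ∫ z, c z ∂ρ)
    (n : ℕ) (q : ℕ → Measure (α × β)) [∀ i, IsProbabilityMeasure (q i)] (hq : q n = q 0)
    {θ : ℝ≥0∞} (hθ : θ ≠ 0) (hθ' : θ ≠ ∞) (hle : θ • ∑ i ∈ Finset.range n, q i ≤ π) :
    ∑ i ∈ Finset.range n, ∫ z, c z ∂q i ≤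
      ∑ i ∈ Finset.range n, ∫ z, c z ∂((q (i + 1)).fst.prod (q i).snd) := by
  set σ : Measure (α × β) := θ • ∑ i ∈ Finset.range n, q i with hσ
  set τ : Measure (α × β) := θ • ∑ i ∈ Finset.range n, (q (i + 1)).fst.prod (q i).snd with hτ
  have hσf : IsFiniteMeasure σ := isFiniteMeasure_of_le π hle
  have hτf : IsFiniteMeasure τ := by
    rw [hτ]
    refine ⟨?_⟩
    simp [ENNReal.mul_lt_top_iff, hθ'.lt_top]
  have hint : ∀ m : Measure (α × β), IsFiniteMeasure m → Integrable c m := fun m _ =>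
    Integrable.of_bound hc.aestronglyMeasurable M (ae_of_all _ hM)
  -- As the chain is closed, shifting the index does not change the sum of first marginals.
  have hmap1 : τ.fst = σ.fst := by
    have h := Finset.sum_range_succ' (fun i => (q i).fst) n
    rw [Finset.sum_range_succ, hq] at h
    ext s hs
    have h' := congrArg (fun m : Measure α => m s) h
    simp only [Measure.coe_add, Pi.add_apply, Measure.coe_finsetSum, Finset.sum_apply] at h'
    have h2 := (ENNReal.add_left_inj (measure_ne_top _ _)).1 h'
    simp only [Measure.fst_apply hs] at h2
    rw [Measure.fst_apply hs, Measure.fst_apply hs]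
    simp only [hσ, hτ, Measure.smul_apply, Measure.coe_finsetSum, Finset.sum_apply, h2]
    congr 1
    refine Finset.sum_congr rfl fun i _ => ?_
    rw [← Measure.fst_apply hs, Measure.fst_prod, Measure.fst_apply hs]
  have hmap2 : τ.snd = σ.snd := by
    ext s hs
    rw [Measure.snd_apply hs, Measure.snd_apply hs]
    simp only [hσ, hτ, Measure.smul_apply, Measure.coe_finsetSum, Finset.sum_apply]
    congr 1
    refine Finset.sum_congr rfl fun i _ => ?_
    rw [← Measure.snd_apply hs, Measure.snd_prod, Measure.snd_apply hs]
  have hπ : π - σ + σ = π := Measure.sub_add_cancel_of_le hle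
  have hρ1 : (π - σ + τ).fst = π.fst := by
    conv_rhs => rw [← hπ]
    simp only [Measure.fst, Measure.map_add _ _ measurable_fst] at hmap1 ⊢
    rw [hmap1]
  have hρ2 : (π - σ + τ).snd = π.snd := by
    conv_rhs => rw [← hπ]
    simp only [Measure.snd, Measure.map_add _ _ measurable_snd] at hmap2 ⊢
    rw [hmap2]
  have hρp : IsProbabilityMeasure (π - σ + τ) := by
    refine ⟨?_⟩
    rw [← Measure.fst_univ, hρ1, Measure.fst_univ, measure_univ]
  have key := hopt _ hρp hρ1 hρ2
  rw [← hπ, integral_add_measure (hint _ inferInstance) (hint _ inferInstance),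
    hπ, integral_add_measure (hint _ inferInstance) (hint _ inferInstance)] at key
  have key2 : ∫ z, c z ∂σ ≤ ∫ z, c z ∂τ := by linarith
  rw [hσ, hτ, integral_smul_measure, integral_smul_measure,
    integral_finsetSum_measure (fun i _ => hint _ inferInstance),
    integral_finsetSum_measure (fun i _ => hint _ inferInstance)] at key2
  exact le_of_smul_le_smul_left key2 (ENNReal.toReal_pos hθ hθ')

end Perturbation

/-- The support of an optimal plan is `c`-cyclically monotone: otherwise small portions of mass
near the points of a chain could be exchanged at a profit. -/
theorem isCyclicallyMonotone_support {α β : Type*} [MetricSpace α] [MetricSpace β]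
    [SecondCountableTopology α] [SecondCountableTopology β]
    [MeasurableSpace α] [MeasurableSpace β] [BorelSpace α] [BorelSpace β]
    {c : α × β → ℝ} (hc : Continuous c) {M : ℝ} (hM : ∀ z, |c z| ≤ M)
    {π : Measure (α × β)} [IsProbabilityMeasure π]
    (hopt : ∀ ρ : Measure (α × β), IsProbabilityMeasure ρ → ρ.fst = π.fst → ρ.snd = π.snd →
        ∫ z, c z ∂π ≤ ∫ z, c z ∂ρ) :
    IsCyclicallyMonotone c π.support := by
  intro n p hp hpn
  rcases Nat.eq_zero_or_pos n with rfl | hn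
  · simp
  refine le_of_forall_pos_le_add fun ε hε => ?_
  have hn' : (0 : ℝ) < n := by exact_mod_cast hn
  set η : ℝ := ε / (2 * n) with hη
  have hη0 : 0 < η := by positivity
  have hnear : ∀ z : α × β, ∀ᶠ δ in 𝓝[>] (0 : ℝ), ∀ w ∈ Metric.ball z δ, |c w - c z| < η := by
    intro z
    obtain ⟨δ, hδ, h⟩ := Metric.continuous_iff.1 hc z η hη0
    filter_upwards [Ioo_mem_nhdsGT hδ] with δ' hδ' w hw
    have := h w ((Metric.mem_ball.1 hw).trans hδ'.2)
    rwa [Real.dist_eq] at this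
  have h1 : ∀ᶠ δ in 𝓝[>] (0 : ℝ), ∀ i ∈ Finset.range n,
      (∀ w ∈ Metric.ball (p i) δ, |c w - c (p i)| < η) ∧
      ∀ w ∈ Metric.ball ((p (i + 1)).1, (p i).2) δ, |c w - c ((p (i + 1)).1, (p i).2)| < η :=
    (Filter.eventually_all_finset _).2 fun i _ => (hnear _).and (hnear _)
  obtain ⟨δ, hδ, hδ0 : 0 < δ⟩ := (h1.and self_mem_nhdsWithin).exists
  let W : ℕ → Set (α × β) := fun i => Metric.ball (p i) δ
  have hWm : ∀ i, MeasurableSet (W i) := fun i => Metric.isOpen_ball.measurableSet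
  have hW0 : ∀ i, π (W i) ≠ 0 := fun i =>
    ((Measure.mem_support_iff_forall _).1 (hp i) _ (Metric.ball_mem_nhds _ hδ0)).ne'
  let q : ℕ → Measure (α × β) := fun i => (π (W i))⁻¹ • π.restrict (W i)
  have hqp : ∀ i, IsProbabilityMeasure (q i) := fun i => by
    refine ⟨?_⟩
    simp [q, ENNReal.inv_mul_cancel (hW0 i) (measure_ne_top _ _)]
  have hqae : ∀ i, ∀ᵐ z ∂q i, z ∈ W i := fun i =>
    Measure.ae_smul_measure (ae_restrict_mem (hWm i)) _
  obtain ⟨k, hk, hkmin⟩ := Finset.exists_min_image (Finset.range n) (fun i => π (W i))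
    ⟨0, Finset.mem_range.2 hn⟩
  -- Each `q i` is at most `π / π (W k)`, so this fraction of all of them fits into `π`.
  set θ : ℝ≥0∞ := π (W k) / n with hθdef
  have hθ : θ ≠ 0 := by
    simp [hθdef, ENNReal.div_eq_zero_iff, hW0 k]
  have hθ' : θ ≠ ∞ := ENNReal.div_ne_top (measure_ne_top _ _) (by exact_mod_cast hn.ne')
  have hle : θ • ∑ i ∈ Finset.range n, q i ≤ π := by
    refine Measure.le_iff.2 fun s hs => ?_
    simp only [Measure.smul_apply, Measure.coe_finsetSum, Finset.sum_apply, smul_eq_mul]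
    have : ∀ i ∈ Finset.range n, q i s ≤ (π (W k))⁻¹ * π s := by
      intro i hi
      simp only [q, Measure.smul_apply, smul_eq_mul]
      exact mul_le_mul' (ENNReal.inv_le_inv.2 (hkmin i hi)) (Measure.restrict_le_self s)
    calc θ * ∑ i ∈ Finset.range n, q i s
        ≤ θ * ∑ _i ∈ Finset.range n, (π (W k))⁻¹ * π s := by
          gcongr with i hi
          exact this i hi
      _ = (π (W k) * (π (W k))⁻¹) * ((n : ℝ≥0∞)⁻¹ * n) * π s := by
          simp only [Finset.sum_const, Finset.card_range, nsmul_eq_mul, hθdef, div_eq_mul_inv]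
          ring
      _ = π s := by
          rw [ENNReal.mul_inv_cancel (hW0 k) (measure_ne_top _ _),
            ENNReal.inv_mul_cancel (by exact_mod_cast hn.ne') (by simp), one_mul, one_mul]
  have hqn : q n = q 0 := by simp only [q, W, hpn]
  have key := sum_integral_le_of_optimal hc.measurable hM hopt n q hqn hθ hθ' hle
  have hint : ∀ m : Measure (α × β), IsFiniteMeasure m → Integrable c m := fun m _ =>
    Integrable.of_bound hc.measurable.aestronglyMeasurable M (ae_of_all _ hM)
  have hlow : ∀ i ∈ Finset.range n, c (p i) - η ≤ ∫ z, c z ∂q i := by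
    intro i hi
    have : ∫ _z, (c (p i) - η) ∂q i ≤ ∫ z, c z ∂q i := by
      refine integral_mono_ae (integrable_const _) (hint _ inferInstance) ?_
      filter_upwards [hqae i] with z hz
      have := abs_lt.1 ((hδ i hi).1 z hz)
      linarith
    simpa using this
  have hup : ∀ i ∈ Finset.range n,
      ∫ z, c z ∂((q (i + 1)).fst.prod (q i).snd) ≤ c ((p (i + 1)).1, (p i).2) + η := by
    intro i hi
    have hA : ∀ᵐ x ∂(q (i + 1)).fst, x ∈ Metric.ball (p (i + 1)).1 δ := by
      refine ae_map_iff measurable_fst.aemeasurable Metric.isOpen_ball.measurableSet |>.2 ?_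
      filter_upwards [hqae (i + 1)] with z hz
      exact (lt_of_le_of_lt (le_max_left _ _) (Metric.mem_ball.1 hz))
    have hB : ∀ᵐ y ∂(q i).snd, y ∈ Metric.ball (p i).2 δ := by
      refine ae_map_iff measurable_snd.aemeasurable Metric.isOpen_ball.measurableSet |>.2 ?_
      filter_upwards [hqae i] with z hz
      exact (lt_of_le_of_lt (le_max_right _ _) (Metric.mem_ball.1 hz))
    have hAB : ∀ᵐ z ∂((q (i + 1)).fst.prod (q i).snd),
        z ∈ Metric.ball ((p (i + 1)).1, (p i).2) δ := by
      filter_upwards [Measure.quasiMeasurePreserving_fst.ae hA,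
        Measure.quasiMeasurePreserving_snd.ae hB] with z h1 h2
      exact Metric.mem_ball.2 (max_lt h1 h2)
    have : ∫ z, c z ∂((q (i + 1)).fst.prod (q i).snd) ≤
        ∫ _z, (c ((p (i + 1)).1, (p i).2) + η) ∂((q (i + 1)).fst.prod (q i).snd) := by
      refine integral_mono_ae (hint _ inferInstance) (integrable_const _) ?_
      filter_upwards [hAB] with z hz
      have := abs_lt.1 ((hδ i hi).2 z hz)
      linarith
    simpa using this
  have e1 := Finset.sum_le_sum hlow
  have e2 := Finset.sum_le_sum hup
  simp only [Finset.sum_sub_distrib, Finset.sum_add_distrib, Finset.sum_const, Finset.card_range,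
    nsmul_eq_mul] at e1 e2
  have e3 : (n : ℝ) * η = ε / 2 := by rw [hη]; field_simp
  linarith

end Kantorovich

/-! ### Conjugate potentials -/

section Potentials

/-- `u` on `X` and `φ` on `Y` are `c`-conjugate to each other:
`u x = sup_{y ∈ Y} (φ y - c (x, y))` and `φ y = inf_{x ∈ X} (u x + c (x, y))`, both spelled out
through approximate optimizers so that the roles of `X` and `Y` are symmetric. -/
structure IsConjugatePair {α β : Type*} (X : Set α) (Y : Set β) (c : α × β → ℝ)
    (u : α → ℝ) (φ : β → ℝ) : Prop where
  le : ∀ x ∈ X, ∀ y ∈ Y, φ y ≤ u x + c (x, y)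
  exists_left : ∀ x ∈ X, ∀ ε > 0, ∃ y ∈ Y, u x + c (x, y) < φ y + ε
  exists_right : ∀ y ∈ Y, ∀ ε > 0, ∃ x ∈ X, u x + c (x, y) < φ y + ε

theorem IsConjugatePair.swap {α β : Type*} {X : Set α} {Y : Set β} {c : α × β → ℝ}
    {u : α → ℝ} {φ : β → ℝ} (h : IsConjugatePair X Y c u φ) :
    IsConjugatePair Y X (fun z => c (z.2, z.1)) (fun y => -φ y) (fun x => -u x) where
  le y hy x hx := by have := h.le x hx y hy; simp only; linarith
  exists_left y hy ε hε := by
    obtain ⟨x, hx, h'⟩ := h.exists_right y hy ε hε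
    exact ⟨x, hx, by simp only; linarith⟩
  exists_right x hx ε hε := by
    obtain ⟨y, hy, h'⟩ := h.exists_left x hx ε hε
    exact ⟨y, hy, by simp only; linarith⟩

/-- Rockafellar's construction: for a bounded cost, a `c`-cyclically monotone set lies in the
contact set of a pair of bounded conjugate potentials. The potential is the supremum, over the
chains in `Γ` starting at a fixed point, of the gain along the chain. -/
theorem IsCyclicallyMonotone.exists_potentials {α β : Type*} {c : α × β → ℝ} {M : ℝ}
    (hM : ∀ z, |c z| ≤ M) {Γ : Set (α × β)} (hΓ : IsCyclicallyMonotone c Γ) (hne : Γ.Nonempty) :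
    ∃ (u : α → ℝ) (φ : β → ℝ), IsConjugatePair univ univ c u φ ∧
      (∃ B, ∀ x, |u x| ≤ B) ∧ (∃ B, ∀ y, |φ y| ≤ B) ∧
      ∀ z ∈ Γ, u z.1 + c z = φ z.2 := by
  obtain ⟨p₀, hp₀⟩ := hne
  have hcl : ∀ z, -M ≤ c z := fun z => (abs_le.1 (hM z)).1
  have hcu : ∀ z, c z ≤ M := fun z => (abs_le.1 (hM z)).2
  let ι := {q : ℕ × (ℕ → α × β) // (∀ i, q.2 i ∈ Γ) ∧ q.2 0 = p₀}
  let val : ι → α → ℝ := fun q x =>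
    (∑ i ∈ Finset.range q.1.1, (c (q.1.2 i) - c ((q.1.2 (i + 1)).1, (q.1.2 i).2))) +
      (c (q.1.2 q.1.1) - c (x, (q.1.2 q.1.1).2))
  let q₀ : ι := ⟨(0, fun _ => p₀), fun _ => hp₀, rfl⟩
  have : Nonempty ι := ⟨q₀⟩
  have : Nonempty α := ⟨p₀.1⟩
  have : Nonempty β := ⟨p₀.2⟩
  -- Appending a point of `Γ` to a chain.
  have step : ∀ (q : ι) (z : α × β), z ∈ Γ →
      ∃ q' : ι, ∀ w, val q' w = val q z.1 + c z - c (w, z.2) := by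
    rintro ⟨⟨n, p⟩, hp, hp0⟩ z hz
    refine ⟨⟨(n + 1, fun i => if i ≤ n then p i else z), fun i => ?_, by simpa using hp0⟩,
      fun w => ?_⟩
    · dsimp only
      split_ifs
      exacts [hp i, hz]
    · have : ∀ i ∈ Finset.range n, (c (if i ≤ n then p i else z) -
          c ((if i + 1 ≤ n then p (i + 1) else z).1, (if i ≤ n then p i else z).2)) =
          c (p i) - c ((p (i + 1)).1, (p i).2) := by
        intro i hi
        have := Finset.mem_range.1 hi
        rw [if_pos (by omega), if_pos (by omega)]
      simp only [val, Finset.sum_range_succ, Finset.sum_congr rfl this]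
      simp
      ring
  -- Closing a chain at its starting point: this is where cyclical monotonicity enters.
  have closed : ∀ q : ι, val q p₀.1 ≤ 0 := by
    rintro ⟨⟨n, p⟩, hp, hp0⟩
    have h := hΓ (n + 1) (fun i => if i ≤ n then p i else p₀)
      (fun i => by split_ifs; exacts [hp i, hp₀]) (by simpa using hp0.symm)
    have h1 : ∀ i ∈ Finset.range n, c (if i ≤ n then p i else p₀) = c (p i) := by
      intro i hi
      have := Finset.mem_range.1 hi
      rw [if_pos (by omega)]
    have h2 : ∀ i ∈ Finset.range n,
        c ((if i + 1 ≤ n then p (i + 1) else p₀).1, (if i ≤ n then p i else p₀).2) =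
          c ((p (i + 1)).1, (p i).2) := by
      intro i hi
      have := Finset.mem_range.1 hi
      rw [if_pos (by omega), if_pos (by omega)]
    simp only [Finset.sum_range_succ, Finset.sum_congr rfl h1, Finset.sum_congr rfl h2] at h
    simp only [le_refl, if_true, Nat.not_succ_le_self, if_false] at h
    simp only [val, Finset.sum_sub_distrib]
    linarith
  have hval : ∀ q x, val q x ≤ 2 * M := by
    intro q x
    have h1 := closed q
    have h2 : val q x = val q p₀.1 + c (p₀.1, (q.1.2 q.1.1).2) - c (x, (q.1.2 q.1.1).2) := by
      simp only [val]; ring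
    linarith [hcu (p₀.1, (q.1.2 q.1.1).2), hcl (x, (q.1.2 q.1.1).2)]
  have hbdd : ∀ x, BddAbove (range fun q => val q x) := fun x =>
    ⟨2 * M, by rintro _ ⟨q, rfl⟩; exact hval q x⟩
  let u₀ : α → ℝ := fun x => ⨆ q, val q x
  have hu₀le : ∀ x, u₀ x ≤ 2 * M := fun x => ciSup_le fun q => hval q x
  have hu₀ge : ∀ x, -(2 * M) ≤ u₀ x := fun x => by
    refine le_trans ?_ (le_ciSup (hbdd x) q₀)
    simp only [val, q₀, Finset.range_zero, Finset.sum_empty]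
    linarith [hcl p₀, hcu (x, p₀.2)]
  have hu₀Γ : ∀ z ∈ Γ, ∀ w, u₀ z.1 + c z ≤ u₀ w + c (w, z.2) := by
    intro z hz w
    have : u₀ z.1 ≤ u₀ w + c (w, z.2) - c z := by
      refine ciSup_le fun q => ?_
      obtain ⟨q', hq'⟩ := step q z hz
      have := le_ciSup (hbdd w) q'
      have h2 := hq' w
      simp only [u₀]
      linarith
    linarith
  let φ : β → ℝ := fun y => ⨅ x, u₀ x + c (x, y)
  have hφb : ∀ y, BddBelow (range fun x => u₀ x + c (x, y)) := fun y =>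
    ⟨-(3 * M), by rintro _ ⟨x, rfl⟩; simp only; linarith [hu₀ge x, hcl (x, y)]⟩
  have hφge : ∀ y, -(3 * M) ≤ φ y := fun y => le_ciInf fun x => by
    linarith [hu₀ge x, hcl (x, y)]
  have hφle : ∀ y x, φ y ≤ u₀ x + c (x, y) := fun y x => ciInf_le (hφb y) x
  have hφle' : ∀ y, φ y ≤ 3 * M := fun y => by
    linarith [hφle y p₀.1, hu₀le p₀.1, hcu (p₀.1, y)]
  have hφΓ : ∀ z ∈ Γ, φ z.2 = u₀ z.1 + c z := fun z hz =>
    le_antisymm (hφle z.2 z.1) (le_ciInf fun w => hu₀Γ z hz w)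
  -- Replacing `u₀` by the conjugate of `φ` keeps the conjugate `φ` and the equality on `Γ`.
  let u : α → ℝ := fun x => ⨆ y, φ y - c (x, y)
  have hub : ∀ x, BddAbove (range fun y => φ y - c (x, y)) := fun x =>
    ⟨u₀ x, by rintro _ ⟨y, rfl⟩; simp only; linarith [hφle y x]⟩
  have huu₀ : ∀ x, u x ≤ u₀ x := fun x => ciSup_le fun y => by linarith [hφle y x]
  have hφu : ∀ x y, φ y ≤ u x + c (x, y) := fun x y => by
    have := le_ciSup (hub x) y
    simp only [u]
    linarith
  refine ⟨u, φ, ⟨fun x _ y _ => hφu x y, fun x _ ε hε => ?_, fun y _ ε hε => ?_⟩,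
    ⟨4 * M, fun x => abs_le.2 ⟨?_, ?_⟩⟩, ⟨3 * M, fun y => abs_le.2 ⟨hφge y, hφle' y⟩⟩,
    fun z hz => ?_⟩
  · obtain ⟨y, hy⟩ := exists_lt_of_lt_ciSup (show u x - ε < ⨆ y, φ y - c (x, y) by
      simp only [u]; linarith)
    exact ⟨y, mem_univ _, by linarith⟩
  · obtain ⟨x, hx⟩ := exists_lt_of_ciInf_lt (show (⨅ x, u₀ x + c (x, y)) < φ y + ε by
      simp only [φ]; linarith)
    exact ⟨x, mem_univ _, by linarith [huu₀ x]⟩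
  · linarith [hφu x p₀.2, hφge p₀.2, hcu (x, p₀.2)]
  · linarith [huu₀ x, hu₀le x, hcl p₀, hcu p₀]
  · refine le_antisymm ?_ (hφu z.1 z.2)
    rw [hφΓ z hz]
    linarith [huu₀ z.1]

/-- Kantorovich duality with attained dual problem: for a cost that is continuous and bounded on
the product of two open sets carrying `μ` and `ν`, there are a coupling of `μ` and `ν` and a pair of
bounded conjugate potentials such that the coupling is carried by their contact set. -/
theorem exists_coupling_potentials {E F : Type*} [TopologicalSpace E] [TopologicalSpace F]
    [PolishSpace E] [PolishSpace F] [MeasurableSpace E] [MeasurableSpace F]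
    [BorelSpace E] [BorelSpace F] {X : Set E} {Y : Set F} (hX : IsOpen X) (hY : IsOpen Y)
    {c : E × F → ℝ} (hc : ContinuousOn c (X ×ˢ Y)) {M : ℝ} (hM : ∀ z ∈ X ×ˢ Y, |c z| ≤ M)
    {μ : Measure E} {ν : Measure F} [IsProbabilityMeasure μ] [IsProbabilityMeasure ν]
    (hμ : ∀ᵐ x ∂μ, x ∈ X) (hν : ∀ᵐ y ∂ν, y ∈ Y) :
    ∃ (u : E → ℝ) (φ : F → ℝ) (π : Measure (E × F)), IsProbabilityMeasure π ∧
      π.fst = μ ∧ π.snd = ν ∧ IsConjugatePair X Y c u φ ∧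
      (∃ B, ∀ x, |u x| ≤ B) ∧ (∃ B, ∀ y, |φ y| ≤ B) ∧
      ∀ᵐ z ∂π, z.1 ∈ X ∧ z.2 ∈ Y ∧ u z.1 + c z = φ z.2 := by
  have : PolishSpace X := hX.polishSpace
  have : PolishSpace Y := hY.polishSpace
  let := TopologicalSpace.upgradeIsCompletelyMetrizable X
  let := TopologicalSpace.upgradeIsCompletelyMetrizable Y
  have hXe : MeasurableEmbedding (Subtype.val : X → E) := .subtype_coe hX.measurableSet
  have hYe : MeasurableEmbedding (Subtype.val : Y → F) := .subtype_coe hY.measurableSet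
  have hμmap : (μ.comap Subtype.val : Measure X).map Subtype.val = μ := by
    rw [hXe.map_comap, Subtype.range_coe, Measure.restrict_eq_self_of_ae_mem hμ]
  have hνmap : (ν.comap Subtype.val : Measure Y).map Subtype.val = ν := by
    rw [hYe.map_comap, Subtype.range_coe, Measure.restrict_eq_self_of_ae_mem hν]
  have hμp : IsProbabilityMeasure (μ.comap Subtype.val : Measure X) :=
    hXe.isProbabilityMeasure_comap (by simpa using hμ)
  have hνp : IsProbabilityMeasure (ν.comap Subtype.val : Measure Y) :=
    hYe.isProbabilityMeasure_comap (by simpa using hν)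
  let j : X × Y → E × F := Prod.map Subtype.val Subtype.val
  have hj : MeasurableEmbedding j := hXe.prodMap hYe
  have hcj : Continuous (c ∘ j) :=
    hc.comp_continuous (by fun_prop) fun z => ⟨z.1.2, z.2.2⟩
  have hMj : ∀ z, |(c ∘ j) z| ≤ M := fun z => hM _ ⟨z.1.2, z.2.2⟩
  obtain ⟨π, hπp, hπ1, hπ2, hopt⟩ := exists_optimal_coupling
    (BoundedContinuousFunction.ofNormedAddCommGroup (c ∘ j) hcj M hMj)
    (μ.comap Subtype.val : Measure X) (ν.comap Subtype.val : Measure Y)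
  have hcyc : IsCyclicallyMonotone (c ∘ j) π.support :=
    isCyclicallyMonotone_support hcj hMj fun ρ hρ h1 h2 =>
      hopt ρ hρ (h1.trans hπ1) (h2.trans hπ2)
  have hsupp : ∀ᵐ z ∂π, z ∈ π.support := Measure.support_mem_ae
  obtain ⟨u, φ, hpair, ⟨B, hB⟩, ⟨B', hB'⟩, hcontact⟩ := hcyc.exists_potentials hMj hsupp.exists
  have hu : ∀ x : X, Function.extend Subtype.val u 0 x = u x := fun x =>
    Subtype.val_injective.extend_apply u 0 x
  have hφ : ∀ y : Y, Function.extend Subtype.val φ 0 y = φ y := fun y =>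
    Subtype.val_injective.extend_apply φ 0 y
  refine ⟨Function.extend Subtype.val u 0, Function.extend Subtype.val φ 0, π.map j,
    Measure.isProbabilityMeasure_map hj.measurable.aemeasurable, ?_, ?_, ⟨?_, ?_, ?_⟩,
    ⟨B, fun x => ?_⟩, ⟨B', fun y => ?_⟩, ?_⟩
  · rw [Measure.fst, Measure.map_map measurable_fst hj.measurable]
    conv_rhs => rw [← hμmap, ← hπ1, Measure.fst,
      Measure.map_map measurable_subtype_coe measurable_fst]
    rfl
  · rw [Measure.snd, Measure.map_map measurable_snd hj.measurable]
    conv_rhs => rw [← hνmap, ← hπ2, Measure.snd,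
      Measure.map_map measurable_subtype_coe measurable_snd]
    rfl
  · intro x hx y hy
    rw [hu ⟨x, hx⟩, hφ ⟨y, hy⟩]
    exact hpair.le ⟨x, hx⟩ trivial ⟨y, hy⟩ trivial
  · intro x hx ε hε
    obtain ⟨y, -, hy⟩ := hpair.exists_left ⟨x, hx⟩ trivial ε hε
    exact ⟨y, y.2, by rw [hu ⟨x, hx⟩, hφ y]; exact hy⟩
  · intro y hy ε hε
    obtain ⟨x, -, hx⟩ := hpair.exists_right ⟨y, hy⟩ trivial ε hε
    exact ⟨x, x.2, by rw [hu x, hφ ⟨y, hy⟩]; exact hx⟩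
  · by_cases hx : x ∈ X
    · rw [hu ⟨x, hx⟩]; exact hB _
    · rw [Function.extend_apply' _ _ _ (by rintro ⟨a, rfl⟩; exact hx a.2)]
      simpa using (abs_nonneg _).trans (hB hsupp.exists.choose.1)
  · by_cases hy : y ∈ Y
    · rw [hφ ⟨y, hy⟩]; exact hB' _
    · rw [Function.extend_apply' _ _ _ (by rintro ⟨a, rfl⟩; exact hy a.2)]
      simpa using (abs_nonneg _).trans (hB' hsupp.exists.choose.2)
  · rw [hj.ae_map_iff]
    filter_upwards [hsupp] with z hz
    refine ⟨z.1.2, z.2.2, ?_⟩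
    have := hcontact z hz
    simp only [j, Prod.map_fst, Prod.map_snd, hu, hφ]
    exact this

end Potentials

/-! ### Semiconvex functions and Alexandrov's theorem -/

section Alexandrov

open Filter Topology
open scoped NNReal RealInnerProductSpace

variable {E : Type*} [NormedAddCommGroup E] [InnerProductSpace ℝ E]

/-- At every point of `B`, the function `u` is touched from below on `B` by a paraboloid of opening
`K` whose slope has norm at most `M`. This is a quantitative form of semiconvexity. -/
def HasLowerParaboloids (B : Set E) (M K : ℝ) (u : E → ℝ) : Prop :=
  ∀ x ∈ B, ∃ p : E, ‖p‖ ≤ M ∧ ∀ w ∈ B, u x + ⟪p, w - x⟫ - K * ‖w - x‖ ^ 2 ≤ u w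

theorem HasLowerParaboloids.lipschitzOnWith {B : Set E} {M K : ℝ} {u : E → ℝ}
    (h : HasLowerParaboloids B M K u) (hK : 0 ≤ K) {R : ℝ} (hR : ∀ x ∈ B, ∀ w ∈ B, ‖w - x‖ ≤ R) :
    LipschitzOnWith (M + K * R).toNNReal u B := by
  have key : ∀ x ∈ B, ∀ w ∈ B, u x - u w ≤ (M + K * R) * ‖w - x‖ := by
    intro x hx w hw
    obtain ⟨p, hp, hp'⟩ := h x hx
    have h1 := hp' w hw
    have h2 : -⟪p, w - x⟫ ≤ M * ‖w - x‖ := by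
      refine (neg_le_abs _).trans ((abs_real_inner_le_norm _ _).trans ?_)
      gcongr
    have h3 : K * ‖w - x‖ ^ 2 ≤ K * R * ‖w - x‖ := by
      rw [sq, ← mul_assoc]
      gcongr
      exact hR x hx w hw
    linarith
  refine LipschitzOnWith.of_dist_le_mul fun x hx w hw => ?_
  have hle : (M + K * R) * ‖w - x‖ ≤ (M + K * R).toNNReal * ‖w - x‖ := by
    gcongr
    exact Real.le_coe_toNNReal _
  rw [Real.dist_eq, dist_eq_norm, abs_sub_le_iff, norm_sub_rev x w]
  refine ⟨(key x hx w hw).trans hle, ?_⟩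
  have := key w hw x hx
  rw [norm_sub_rev] at this
  exact this.trans hle

section Measure

variable [FiniteDimensional ℝ E] [MeasurableSpace E] [BorelSpace E]

/-- A Lipschitz self-map of a finite-dimensional space sends null sets to null sets. -/
theorem LipschitzWith.addHaar_image_eq_zero (μ : Measure E) [μ.IsAddHaarMeasure] {C : ℝ≥0}
    {F : E → E} (hF : LipschitzWith C F) {s : Set E} (hs : μ s = 0) : μ (F '' s) = 0 := by
  have hac : μ ≪ μH[Module.finrank ℝ E] := Measure.absolutelyContinuous_isAddHaarMeasure _ _
  have hac' : (μH[Module.finrank ℝ E] : Measure E) ≪ μ :=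
    Measure.absolutelyContinuous_isAddHaarMeasure _ _
  refine hac (le_antisymm ?_ zero_le)
  refine (hF.hausdorffMeasure_image_le (Nat.cast_nonneg _) s).trans ?_
  rw [hac' hs, mul_zero]

theorem HasLowerParaboloids.ae_differentiableAt (μ : Measure E) [μ.IsAddHaarMeasure]
    {B : Set E} {M K : ℝ} {u : E → ℝ} (h : HasLowerParaboloids B M K u) (hK : 0 ≤ K)
    (hB : IsOpen B) (hBb : Bornology.IsBounded B) : ∀ᵐ x ∂μ, x ∈ B → DifferentiableAt ℝ u x := by
  obtain ⟨R, hR⟩ := Metric.isBounded_iff.1 hBb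
  have hL := h.lipschitzOnWith hK (R := R) fun x hx w hw => by
    rw [← dist_eq_norm]; exact hR hw hx
  filter_upwards [hL.ae_differentiableWithinAt_of_mem (μ := μ)] with x hx hxB
  exact (hx hxB).differentiableAt (hB.mem_nhds hxB)

end Measure

variable [CompleteSpace E]

/-- A paraboloid touching `u` from below at a point of differentiability has slope `∇ u`. -/
theorem gradient_eq_of_lower_paraboloid {B : Set E} {K : ℝ} {u : E → ℝ} {x p : E} (hB : B ∈ 𝓝 x)
    (hu : DifferentiableAt ℝ u x)
    (hp : ∀ w ∈ B, u x + ⟪p, w - x⟫ - K * ‖w - x‖ ^ 2 ≤ u w) : gradient u x = p := by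
  have hmin : IsLocalMin (fun w => u w - ⟪p, w - x⟫ + K * ‖w - x‖ ^ 2) x := by
    filter_upwards [hB] with w hw
    have := hp w hw
    simp only [sub_self, inner_zero_right, norm_zero]
    linarith
  have hsub : HasFDerivAt (fun w : E => w - x) (ContinuousLinearMap.id ℝ E) x :=
    (hasFDerivAt_id x).sub_const x
  have h1 : HasFDerivAt (fun w => ⟪p, w - x⟫) (InnerProductSpace.toDual ℝ E p) x := by
    have := (InnerProductSpace.toDual ℝ E p).hasFDerivAt.comp x hsub
    simpa [Function.comp_def] using this
  have h2 : HasFDerivAt (fun w => K * ‖w - x‖ ^ 2) (0 : E →L[ℝ] ℝ) x := by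
    have := hsub.norm_sq.const_mul K
    simpa using this
  have h3 := hmin.hasFDerivAt_eq_zero ((hu.hasFDerivAt.sub h1).add h2)
  rw [add_zero, sub_eq_zero] at h3
  rw [gradient, h3, LinearIsometryEquiv.symm_apply_apply]

theorem HasLowerParaboloids.gradient_le {B : Set E} {M K : ℝ} {u : E → ℝ}
    (h : HasLowerParaboloids B M K u) (hB : IsOpen B) {x : E} (hx : x ∈ B)
    (hu : DifferentiableAt ℝ u x) :
    ∀ w ∈ B, u x + ⟪gradient u x, w - x⟫ - K * ‖w - x‖ ^ 2 ≤ u w := by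
  obtain ⟨p, -, hp⟩ := h x hx
  rwa [gradient_eq_of_lower_paraboloid (hB.mem_nhds hx) hu hp]

/-- The gradient of a function with lower paraboloids is continuous on its domain. -/
theorem HasLowerParaboloids.tendsto_gradient {B : Set E} {M K : ℝ} {u : E → ℝ}
    (h : HasLowerParaboloids B M K u) (hK : 0 ≤ K) (hB : IsOpen B) {x : E} (hx : x ∈ B)
    (hu : DifferentiableAt ℝ u x) :
    Tendsto (gradient u) (𝓝[{x | x ∈ B ∧ DifferentiableAt ℝ u x}] x) (𝓝 (gradient u x)) := by
  rw [Metric.tendsto_nhds]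
  intro ε hε
  -- The comparison below gives `‖∇u(x') - ∇u(x)‖ ≤ 2 η + 2 K s`, where `s = ‖x' - x‖`.
  set η : ℝ := ε / 8 with hη
  have hη0 : 0 < η := by positivity
  have hlo := (hasGradientAt_iff_isLittleO.1 hu.hasGradientAt).def hη0
  obtain ⟨r, hr, hball⟩ := Metric.eventually_nhds_iff_ball.1 (hlo.and (hB.mem_nhds hx))
  have hr' : 0 < min (r / 2) (ε / (8 * (K + 1))) := by positivity
  filter_upwards [nhdsWithin_le_nhds (Metric.ball_mem_nhds x hr'), self_mem_nhdsWithin]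
    with x' hx' hx'D
  rcases eq_or_ne x' x with rfl | hne
  · simpa using hε
  set s : ℝ := ‖x' - x‖ with hs
  have hs0 : 0 < s := norm_pos_iff.2 (sub_ne_zero.2 hne)
  rw [Metric.mem_ball, dist_eq_norm, lt_min_iff] at hx'
  obtain ⟨hs1, hs2⟩ := hx'
  rw [lt_div_iff₀ (by positivity)] at hs2
  set d : E := gradient u x' - gradient u x with hd
  rw [dist_eq_norm, ← hd]
  rcases eq_or_ne d 0 with hd0 | hd0
  · simpa [hd0] using hε
  have hdn : 0 < ‖d‖ := norm_pos_iff.2 hd0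
  -- Test the two lower paraboloids at the point `w` at distance `s` from `x'` in direction `d`.
  set v : E := (s / ‖d‖) • d with hv
  have hvn : ‖v‖ = s := by
    rw [hv, norm_smul, Real.norm_of_nonneg (by positivity), div_mul_cancel₀ _ hdn.ne']
  set w : E := x' + v with hw
  have hwx : ‖w - x‖ ≤ 2 * s := by
    have : w - x = (x' - x) + v := by rw [hw]; abel
    rw [this]
    calc ‖x' - x + v‖ ≤ ‖x' - x‖ + ‖v‖ := norm_add_le _ _
      _ = 2 * s := by rw [hvn, ← hs]; ring
  have hwr : w ∈ Metric.ball x r := by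
    rw [Metric.mem_ball, dist_eq_norm]
    linarith
  obtain ⟨hw1, hwB⟩ := hball w hwr
  have e1 := h.gradient_le hB hx'D.1 hx'D.2 w hwB
  have e2 := h.gradient_le hB hx hu x' hx'D.1
  have e3 : u w - u x - ⟪gradient u x, w - x⟫ ≤ η * (2 * s) := by
    refine (le_abs_self _).trans ?_
    rw [← Real.norm_eq_abs]
    refine hw1.trans ?_
    gcongr
  have hwx' : w - x' = v := by rw [hw]; abel
  rw [hwx', hvn] at e1
  rw [← hs] at e2
  have e4 : ⟪gradient u x, w - x⟫ = ⟪gradient u x, x' - x⟫ + ⟪gradient u x, v⟫ := by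
    rw [← inner_add_right, hw]; congr 1; abel
  have e5 : ⟪gradient u x', v⟫ - ⟪gradient u x, v⟫ = s * ‖d‖ := by
    rw [← inner_sub_left, ← hd, hv, inner_smul_right, real_inner_self_eq_norm_sq]
    field_simp
  have e6 : s * ‖d‖ ≤ s * (2 * η + 2 * K * s) := by nlinarith
  have e7 := le_of_mul_le_mul_left e6 hs0
  nlinarith

/-- The expansion estimate behind Alexandrov's theorem: adding a multiple of the identity to the
gradient makes it expansive, so that its inverse is `1`-Lipschitz. -/
theorem HasLowerParaboloids.norm_sub_le {B : Set E} {M K : ℝ} {u : E → ℝ}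
    (h : HasLowerParaboloids B M K u) (hB : IsOpen B) {x x' : E} (hx : x ∈ B)
    (hu : DifferentiableAt ℝ u x) (hx' : x' ∈ B) (hu' : DifferentiableAt ℝ u x') :
    ‖x - x'‖ ≤
      ‖((2 * K + 1) • x + gradient u x) - ((2 * K + 1) • x' + gradient u x')‖ := by
  rcases eq_or_ne x x' with rfl | hne
  · simp
  have h1 := h.gradient_le hB hx hu x' hx'
  have h2 := h.gradient_le hB hx' hu' x hx
  have h3 : ⟪gradient u x, x' - x⟫ = -⟪gradient u x, x - x'⟫ := by
    rw [← inner_neg_right, neg_sub]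
  rw [h3, norm_sub_rev] at h1
  have h4 : ((2 * K + 1) • x + gradient u x) - ((2 * K + 1) • x' + gradient u x') =
      (2 * K + 1) • (x - x') + (gradient u x - gradient u x') := by
    rw [smul_sub]; abel
  have h5 : ‖x - x'‖ ^ 2 ≤
      ⟪((2 * K + 1) • x + gradient u x) - ((2 * K + 1) • x' + gradient u x'), x - x'⟫ := by
    rw [h4, inner_add_left, inner_smul_left, real_inner_self_eq_norm_sq, inner_sub_left]
    simp only [conj_trivial]
    nlinarith
  have h6 := h5.trans (real_inner_le_norm _ _)
  rw [sq] at h6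
  exact le_of_mul_le_mul_right h6 (norm_pos_iff.2 (sub_ne_zero.2 hne))

variable [FiniteDimensional ℝ E] [MeasurableSpace E] [BorelSpace E]

/-- **Alexandrov's theorem**: the gradient of a semiconvex function is differentiable almost
everywhere, relative to the set where it exists. The map `(2K+1) id + ∇u` has a `1`-Lipschitz
inverse `J`. By Rademacher's theorem and Sard's lemma, almost every point is of the form `J z` with
`J` differentiable at `z` with invertible derivative. -/
theorem HasLowerParaboloids.ae_hasFDerivWithinAt_gradient (μ : Measure E) [μ.IsAddHaarMeasure]
    {B : Set E} {M K : ℝ} {u : E → ℝ} (h : HasLowerParaboloids B M K u) (hK : 0 ≤ K)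
    (hB : IsOpen B) :
    ∀ᵐ x ∂μ, x ∈ B → DifferentiableAt ℝ u x →
      DifferentiableWithinAt ℝ (gradient u) {x | x ∈ B ∧ DifferentiableAt ℝ u x} x := by
  set D : Set E := {x | x ∈ B ∧ DifferentiableAt ℝ u x} with hD
  set G : E → E := fun x => (2 * K + 1) • x + gradient u x with hG
  have hexp : ∀ x ∈ D, ∀ x' ∈ D, ‖x - x'‖ ≤ ‖G x - G x'‖ := fun x hx x' hx' =>
    h.norm_sub_le hB hx.1 hx.2 hx'.1 hx'.2
  have hinj : InjOn G D := by
    intro x hx x' hx' hxx'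
    have := hexp x hx x' hx'
    rw [hxx', sub_self, norm_zero] at this
    exact sub_eq_zero.1 (norm_le_zero_iff.1 this)
  have hleft : ∀ x ∈ D, Function.invFunOn G D (G x) = x := fun x hx => hinj.leftInvOn_invFunOn hx
  have hlip : LipschitzOnWith 1 (Function.invFunOn G D) (G '' D) := by
    refine LipschitzOnWith.of_dist_le_mul ?_
    rintro _ ⟨x, hx, rfl⟩ _ ⟨x', hx', rfl⟩
    rw [hleft x hx, hleft x' hx', dist_eq_norm, dist_eq_norm, NNReal.coe_one, one_mul]
    exact hexp x hx x' hx'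
  obtain ⟨J, hJ, hJeq⟩ := hlip.extend_finite_dimension
  have hJG : ∀ x ∈ D, J (G x) = x := fun x hx => by
    rw [← hJeq (mem_image_of_mem G hx), hleft x hx]
  have hnull1 : μ (J '' {z | ¬DifferentiableAt ℝ J z}) = 0 :=
    hJ.addHaar_image_eq_zero μ (ae_iff.1 (hJ.ae_differentiableAt (μ := μ)))
  have hnull2 : μ (J '' {z | DifferentiableAt ℝ J z ∧ (fderiv ℝ J z).det = 0}) = 0 :=
    addHaar_image_eq_zero_of_det_fderivWithin_eq_zero μ (f' := fderiv ℝ J)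
      (fun z hz => hz.1.hasFDerivAt.hasFDerivWithinAt) fun z hz => hz.2
  filter_upwards [measure_eq_zero_iff_ae_notMem.1 hnull1, measure_eq_zero_iff_ae_notMem.1 hnull2]
    with x hx1 hx2 hxB hxu
  have hxD : x ∈ D := ⟨hxB, hxu⟩
  have hd : DifferentiableAt ℝ J (G x) := by
    by_contra hcon
    exact hx1 ⟨G x, hcon, hJG x hxD⟩
  have hdet : (fderiv ℝ J (G x)).det ≠ 0 := fun hcon => hx2 ⟨G x, ⟨hd, hcon⟩, hJG x hxD⟩
  have hJd : HasFDerivAt J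
      (((fderiv ℝ J (G x)).toContinuousLinearEquivOfDetNeZero hdet : E ≃L[ℝ] E) : E →L[ℝ] E)
      (G x) := by
    rw [ContinuousLinearMap.coe_toContinuousLinearEquivOfDetNeZero]
    exact hd.hasFDerivAt
  have hGc : Tendsto G (𝓝[D] x) (𝓝[univ] (G x)) := by
    rw [nhdsWithin_univ]
    exact ((continuous_const_smul (2 * K + 1)).continuousAt.mono_left nhdsWithin_le_nhds).add
      (h.tendsto_gradient hK hB hxB hxu)
  have hGd := HasFDerivWithinAt.of_local_left_inverse hGc hJd.hasFDerivWithinAt hxD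
    (eventually_nhdsWithin_of_forall hJG)
  have := hGd.differentiableWithinAt.sub
    ((differentiableWithinAt_id (𝕜 := ℝ) (s := D) (x := x)).const_smul (2 * K + 1))
  refine this.congr_of_eventuallyEq (Eventually.of_forall fun y => ?_) ?_ <;> simp [hG]

end Alexandrov

/-! ### Regularity of the potentials and of the map `T_u` -/

section Cost

open Filter Topology
open scoped RealInnerProductSpace

variable {n : ℕ} {X Y : Set (EuclideanSpace ℝ (Fin n))}
  {c : EuclideanSpace ℝ (Fin n) × EuclideanSpace ℝ (Fin n) → ℝ}

theorem CondC0.swap (h : CondC0 X Y c) : CondC0 Y X (fun z => c (z.2, z.1)) := by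
  obtain ⟨h1, M, hM⟩ := h
  refine ⟨h1.comp (contDiff_snd.prodMk contDiff_fst).contDiffOn fun z hz => ⟨hz.2, hz.1⟩,
    M, fun k hk z hz => ?_⟩
  have := (LinearIsometryEquiv.prodComm ℝ (EuclideanSpace ℝ (Fin n))
    (EuclideanSpace ℝ (Fin n))).norm_iteratedFDeriv_comp_right c z k
  refine (le_of_eq this).trans (hM k hk _ ⟨hz.2, hz.1⟩)

/-- The consequences of a uniform `C²` bound that are used for the potentials: on `X × Y` the cost
and its partial gradient in `x` are bounded by `M`, and the first-order Taylor expansion in `x` has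
a quadratic error on convex subsets of `X`. -/
structure HasTaylorBound (X Y : Set (EuclideanSpace ℝ (Fin n)))
    (c : EuclideanSpace ℝ (Fin n) × EuclideanSpace ℝ (Fin n) → ℝ) (M : ℝ) : Prop where
  nonneg : 0 ≤ M
  abs_le : ∀ z ∈ X ×ˢ Y, |c z| ≤ M
  hasGradientAt : ∀ x ∈ X, ∀ y ∈ Y, HasGradientAt (fun x' => c (x', y)) (gradX c x y) x
  norm_gradX_le : ∀ x ∈ X, ∀ y ∈ Y, ‖gradX c x y‖ ≤ M
  taylor : ∀ B ⊆ X, Convex ℝ B → ∀ x ∈ B, ∀ w ∈ B, ∀ y ∈ Y,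
    |c (w, y) - c (x, y) - ⟪gradX c x y, w - x⟫| ≤ M * ‖w - x‖ ^ 2

theorem hasFDerivAt_partial_fst {x y : EuclideanSpace ℝ (Fin n)}
    (h : DifferentiableAt ℝ c (x, y)) : HasFDerivAt (fun x' => c (x', y))
      ((fderiv ℝ c (x, y)).comp (ContinuousLinearMap.inl ℝ _ _)) x :=
  h.hasFDerivAt.comp x (hasFDerivAt_prodMk_left x y)

theorem gradX_eq {x y : EuclideanSpace ℝ (Fin n)} (h : DifferentiableAt ℝ c (x, y)) :
    gradX c x y = (InnerProductSpace.toDual ℝ _).symm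
      ((fderiv ℝ c (x, y)).comp (ContinuousLinearMap.inl ℝ _ _)) := by
  rw [gradX, gradient, (hasFDerivAt_partial_fst h).fderiv]

theorem CondC0.contDiffAt (h : CondC0 X Y c) (hX : IsOpen X) (hY : IsOpen Y)
    {z : EuclideanSpace ℝ (Fin n) × EuclideanSpace ℝ (Fin n)} (hz : z ∈ X ×ˢ Y) :
    ContDiffAt ℝ 4 c z :=
  h.1.contDiffAt ((hX.prod hY).mem_nhds hz)

theorem CondC0.exists_hasTaylorBound (h : CondC0 X Y c) (hX : IsOpen X) (hY : IsOpen Y) :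
    ∃ M, HasTaylorBound X Y c M := by
  obtain ⟨M, hM⟩ := h.2
  have hd : ∀ z ∈ X ×ˢ Y, DifferentiableAt ℝ c z := fun z hz =>
    (h.contDiffAt hX hY hz).differentiableAt (by norm_num)
  have hinl : ‖ContinuousLinearMap.inl ℝ (EuclideanSpace ℝ (Fin n)) (EuclideanSpace ℝ (Fin n))‖
      ≤ 1 := ContinuousLinearMap.norm_inl_le_one ℝ _ _
  have hd2 : ∀ z ∈ X ×ˢ Y, DifferentiableAt ℝ (fderiv ℝ c) z := fun z hz =>
    ((h.contDiffAt hX hY hz).fderiv_right (m := 3) (by norm_num)).differentiableAt (by norm_num)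
  have h1 : ∀ z ∈ X ×ˢ Y, ‖fderiv ℝ c z‖ ≤ M := fun z hz => by
    have := hM 1 (by norm_num) z hz
    rwa [norm_iteratedFDeriv_one] at this
  have h2 : ∀ z ∈ X ×ˢ Y, ‖fderiv ℝ (fderiv ℝ c) z‖ ≤ M := fun z hz => by
    have := hM 2 (by norm_num) z hz
    rwa [← norm_iteratedFDeriv_fderiv, norm_iteratedFDeriv_one] at this
  have hcomp : ∀ L : EuclideanSpace ℝ (Fin n) × EuclideanSpace ℝ (Fin n) →L[ℝ] ℝ,
      ‖L.comp (ContinuousLinearMap.inl ℝ _ _)‖ ≤ ‖L‖ := fun L =>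
    (L.opNorm_comp_le _).trans (mul_le_of_le_one_right (norm_nonneg _) hinl)
  refine ⟨max M 0, le_max_right _ _, fun z hz => ?_, fun x hx y hy => ?_, fun x hx y hy => ?_,
    fun B hBX hB x hx w hw y hy => ?_⟩
  · have := hM 0 (by norm_num) z hz
    rw [norm_iteratedFDeriv_zero, Real.norm_eq_abs] at this
    exact this.trans (le_max_left _ _)
  · exact (hasFDerivAt_partial_fst (hd _ ⟨hx, hy⟩)).differentiableAt.hasGradientAt
  · rw [gradX_eq (hd _ ⟨hx, hy⟩), LinearIsometryEquiv.norm_map]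
    exact (hcomp _).trans ((h1 _ ⟨hx, hy⟩).trans (le_max_left _ _))
  · have hseg : segment ℝ x w ⊆ B := hB.segment_subset hx hw
    have hlip : ∀ x' ∈ segment ℝ x w, ‖fderiv ℝ c (x', y) - fderiv ℝ c (x, y)‖ ≤
        max M 0 * ‖w - x‖ := by
      intro x' hx'
      have := (convex_segment x w).norm_image_sub_le_of_norm_hasFDerivWithin_le
        (f := fun x' => fderiv ℝ c (x', y))
        (f' := fun x' => (fderiv ℝ (fderiv ℝ c) (x', y)).comp (ContinuousLinearMap.inl ℝ _ _))
        (C := max M 0) (fun a ha => ((hd2 _ ⟨hBX (hseg ha), hy⟩).hasFDerivAt.comp a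
          (hasFDerivAt_prodMk_left a y)).hasFDerivWithinAt)
        (fun a ha => ((ContinuousLinearMap.opNorm_comp_le _ _).trans
          (mul_le_of_le_one_right (norm_nonneg _) hinl)).trans
            ((h2 _ ⟨hBX (hseg ha), hy⟩).trans (le_max_left _ _)))
        (left_mem_segment ℝ x w) hx'
      refine this.trans ?_
      gcongr
      obtain ⟨t, ht, rfl⟩ := (segment_eq_image' ℝ x w ▸ hx' :
        x' ∈ (fun θ : ℝ => x + θ • (w - x)) '' Icc 0 1)
      rw [add_sub_cancel_left, norm_smul, Real.norm_of_nonneg ht.1]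
      exact mul_le_of_le_one_left (norm_nonneg _) ht.2
    have := (convex_segment x w).norm_image_sub_le_of_norm_hasFDerivWithin_le'
      (f := fun x' => c (x', y))
      (f' := fun x' => (fderiv ℝ c (x', y)).comp (ContinuousLinearMap.inl ℝ _ _))
      (φ := (fderiv ℝ c (x, y)).comp (ContinuousLinearMap.inl ℝ _ _))
      (C := max M 0 * ‖w - x‖)
      (fun a ha => (hasFDerivAt_partial_fst (hd _ ⟨hBX (hseg ha), hy⟩)).hasFDerivWithinAt)
      (fun a ha => by
        rw [← ContinuousLinearMap.sub_comp]
        exact (hcomp _).trans (hlip a ha))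
      (left_mem_segment ℝ x w) (right_mem_segment ℝ x w)
    rw [Real.norm_eq_abs, mul_assoc, ← sq] at this
    rwa [gradX_eq (hd _ ⟨hBX hx, hy⟩), InnerProductSpace.toDual_symm_apply]

/-- A potential inherits lower paraboloids from the cost: take approximate maximizers `y` in
`u x = sup (φ y - c (x, y))` and a limit point of the corresponding slopes `-D_x c (x, y)`. -/
theorem IsConjugatePair.hasLowerParaboloids {u φ : EuclideanSpace ℝ (Fin n) → ℝ} {M : ℝ}
    (h : IsConjugatePair X Y c u φ) (hc : HasTaylorBound X Y c M)
    {B : Set (EuclideanSpace ℝ (Fin n))} (hBX : B ⊆ X) (hB : Convex ℝ B) :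
    HasLowerParaboloids B M M u := by
  intro x hx
  choose y hyY hy using fun k : ℕ => h.exists_left x (hBX hx) (1 / ((k : ℝ) + 1))
    Nat.one_div_pos_of_nat
  obtain ⟨p, hp, θ, hθ, hlim⟩ :=
    (isCompact_closedBall (0 : EuclideanSpace ℝ (Fin n)) M).tendsto_subseq (x := fun k => -gradX c x (y k)) fun k => by
      rw [mem_closedBall_zero_iff, norm_neg]
      exact hc.norm_gradX_le x (hBX hx) _ (hyY k)
  refine ⟨p, mem_closedBall_zero_iff.1 hp, fun w hw => ?_⟩
  have hk : ∀ k : ℕ, u x - 1 / ((k : ℝ) + 1) + ⟪-gradX c x (y k), w - x⟫ - M * ‖w - x‖ ^ 2 ≤ u w := by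
    intro k
    have e1 := h.le w (hBX hw) (y k) (hyY k)
    have e2 := hy k
    have e3 := (_root_.abs_le.1 (hc.taylor B hBX hB x hx w hw (y k) (hyY k))).2
    rw [inner_neg_left]
    linarith
  have hlim2 : Tendsto (fun k => u x - 1 / ((θ k : ℝ) + 1) + ⟪-gradX c x (y (θ k)), w - x⟫ -
      M * ‖w - x‖ ^ 2) atTop (𝓝 (u x - 0 + ⟪p, w - x⟫ - M * ‖w - x‖ ^ 2)) :=
    ((tendsto_const_nhds.sub ((tendsto_one_div_add_atTop_nhds_zero_nat (𝕜 := ℝ)).comp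
      hθ.tendsto_atTop)).add (hlim.inner tendsto_const_nhds)).sub tendsto_const_nhds
  rw [sub_zero] at hlim2
  exact le_of_tendsto hlim2 (Eventually.of_forall fun k => hk (θ k))

theorem ae_of_forall_ball {p : EuclideanSpace ℝ (Fin n) → Prop}
    (hX : IsOpen X) (h : ∀ z r, Metric.ball z r ⊆ X → ∀ᵐ x, x ∈ Metric.ball z r → p x) :
    ∀ᵐ x, x ∈ X → p x := by
  have : volume {x | x ∈ X ∧ ¬ p x} = 0 := by
    refine measure_null_of_locally_null _ fun x hx => ?_
    obtain ⟨r, hr, hball⟩ := Metric.isOpen_iff.1 hX x hx.1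
    refine ⟨_, inter_mem_nhdsWithin _ (Metric.ball_mem_nhds x hr), ?_⟩
    refine measure_mono_null ?_ (ae_iff.1 (h x r hball))
    rintro w ⟨⟨-, hw⟩, hwb⟩ hcon
    exact hw (hcon hwb)
  rw [ae_iff]
  convert this using 3
  ext x
  simp

variable {u φ : EuclideanSpace ℝ (Fin n) → ℝ} {M : ℝ}

theorem IsConjugatePair.ae_differentiableAt (h : IsConjugatePair X Y c u φ)
    (hc : HasTaylorBound X Y c M) (hX : IsOpen X) :
    ∀ᵐ x, x ∈ X → DifferentiableAt ℝ u x :=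
  ae_of_forall_ball hX fun z r hB =>
    (h.hasLowerParaboloids hc hB (convex_ball z r)).ae_differentiableAt volume hc.nonneg
      Metric.isOpen_ball Metric.isBounded_ball

theorem IsConjugatePair.ae_differentiableWithinAt_gradient (h : IsConjugatePair X Y c u φ)
    (hc : HasTaylorBound X Y c M) (hX : IsOpen X) :
    ∀ᵐ x, x ∈ X → DifferentiableAt ℝ u x →
      DifferentiableWithinAt ℝ (gradient u) {x | x ∈ X ∧ DifferentiableAt ℝ u x} x := by
  refine ae_of_forall_ball hX fun z r hB => ?_
  filter_upwards [(h.hasLowerParaboloids hc hB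
    (convex_ball z r)).ae_hasFDerivWithinAt_gradient volume hc.nonneg Metric.isOpen_ball]
    with x hx hxB hxu
  refine (hx hxB hxu).mono_of_mem_nhdsWithin ?_
  filter_upwards [self_mem_nhdsWithin, nhdsWithin_le_nhds (Metric.isOpen_ball.mem_nhds hxB)]
    with w hw hwB using ⟨hwB, hw.2⟩

theorem IsConjugatePair.continuousOn_left (h : IsConjugatePair X Y c u φ)
    (hc : HasTaylorBound X Y c M) (hX : IsOpen X) : ContinuousOn u X := by
  intro x hx
  obtain ⟨r, hr, hball⟩ := Metric.isOpen_iff.1 hX x hx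
  obtain ⟨R, hR⟩ := Metric.isBounded_iff.1 (Metric.isBounded_ball (x := x) (r := r))
  have := ((h.hasLowerParaboloids hc hball (convex_ball x r)).lipschitzOnWith hc.nonneg
    (R := R) fun x hx w hw => by rw [← dist_eq_norm]; exact hR hw hx).continuousOn
  exact (this.continuousAt (Metric.ball_mem_nhds x hr)).continuousWithinAt

/-- At a contact point `(x, y)` where `u` is differentiable, the function `u + c(·, y)` attains its
minimum, so `∇u(x) = -D_x c(x, y)`. -/
theorem IsConjugatePair.gradient_eq (h : IsConjugatePair X Y c u φ)
    (hc : HasTaylorBound X Y c M) (hX : IsOpen X) {x y : EuclideanSpace ℝ (Fin n)}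
    (hx : x ∈ X) (hy : y ∈ Y) (hu : DifferentiableAt ℝ u x) (hxy : u x + c (x, y) = φ y) :
    gradient u x = -gradX c x y := by
  have hmin : IsLocalMin (fun x' => u x' + c (x', y)) x := by
    filter_upwards [hX.mem_nhds hx] with w hw
    rw [hxy]
    exact h.le w hw y hy
  have h1 := hmin.hasFDerivAt_eq_zero
    (hu.hasFDerivAt.add (hasGradientAt_iff_hasFDerivAt.1 (hc.hasGradientAt x hx y hy)))
  rw [gradient, eq_neg_of_add_eq_zero_left h1, map_neg, LinearIsometryEquiv.symm_apply_apply]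

theorem cMap_spec {x : EuclideanSpace ℝ (Fin n)} (hx : x ∈ cMapDomain X Y c u) :
    cMap c Y u x ∈ Y ∧ gradient u x = -gradX c x (cMap c Y u x) :=
  Classical.epsilon_spec hx.2.2

theorem cMap_eq (hC1 : CondC1 X Y c) {x y : EuclideanSpace ℝ (Fin n)}
    (hx : x ∈ cMapDomain X Y c u) (hy : y ∈ Y) (hxy : gradient u x = -gradX c x y) :
    cMap c Y u x = y :=
  hC1 x hx.1 (cMap_spec hx).1 hy ((cMap_spec hx).2.symm.trans hxy)

theorem IsConjugatePair.mem_cMapDomain_and_cMap_eq (h : IsConjugatePair X Y c u φ)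
    (hc : HasTaylorBound X Y c M) (hX : IsOpen X) (hC1 : CondC1 X Y c)
    {x y : EuclideanSpace ℝ (Fin n)} (hx : x ∈ X) (hy : y ∈ Y) (hu : DifferentiableAt ℝ u x)
    (hxy : u x + c (x, y) = φ y) : x ∈ cMapDomain X Y c u ∧ cMap c Y u x = y := by
  have hg := h.gradient_eq hc hX hx hy hu hxy
  have hD : x ∈ cMapDomain X Y c u := ⟨hx, hu, y, hy, hg⟩
  exact ⟨hD, cMap_eq hC1 hD hy hg⟩

/-- Where `∇u` is differentiable and `D_{xy} c` is nondegenerate, so is `T_u` differentiable: near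
the point, `T_u(x) = ψ(x, ∇u(x))` for the smooth local solution `ψ(x, p)` of `p + D_x c(x, y) = 0`.
Injectivity of `D_x c(x, ·)` on the whole of `Y` identifies `T_u` with this local branch. -/
theorem differentiableWithinAt_cMap (hC0 : CondC0 X Y c) (hC1 : CondC1 X Y c) (hX : IsOpen X)
    (hY : IsOpen Y) {x : EuclideanSpace ℝ (Fin n)} (hx : x ∈ cMapDomain X Y c u)
    (hu : DifferentiableWithinAt ℝ (gradient u) {x | x ∈ X ∧ DifferentiableAt ℝ u x} x)
    (hdet : (mixedHessian c x (cMap c Y u x)).det ≠ 0) :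
    DifferentiableWithinAt ℝ (cMap c Y u) (cMapDomain X Y c u) x := by
  obtain ⟨hyY, hgrad⟩ := cMap_spec hx
  set y := cMap c Y u x with hy
  have hcd : ContDiffAt ℝ 1 (fun z : EuclideanSpace ℝ (Fin n) × EuclideanSpace ℝ (Fin n) =>
      gradX c z.1 z.2) (x, y) := by
    have h1 : ContDiffAt ℝ 1 (fderiv ℝ c) (x, y) :=
      (hC0.contDiffAt hX hY (z := (x, y)) ⟨hx.1, hyY⟩).fderiv_right (by norm_num)
    have h2 : ContDiffAt ℝ 1 (fun z => (InnerProductSpace.toDual ℝ _).symm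
        ((fderiv ℝ c z).comp (ContinuousLinearMap.inl ℝ _ _))) (x, y) :=
      (InnerProductSpace.toDual ℝ
        (EuclideanSpace ℝ (Fin n))).symm.contDiff.contDiffAt.comp _ (h1.clm_comp contDiffAt_const)
    refine h2.congr_of_eventuallyEq ?_
    filter_upwards [(hX.prod hY).mem_nhds (show (x, y) ∈ X ×ˢ Y from ⟨hx.1, hyY⟩)] with z hz
    exact gradX_eq ((hC0.contDiffAt hX hY hz).differentiableAt (by norm_num))
  -- The function `((x, p), y) ↦ p + D_x c (x, y)`, to be solved for `y`.
  let Ψ : (EuclideanSpace ℝ (Fin n) × EuclideanSpace ℝ (Fin n)) × EuclideanSpace ℝ (Fin n) →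
      EuclideanSpace ℝ (Fin n) := fun z => z.1.2 + gradX c z.1.1 z.2
  have hΨc : ContDiffAt ℝ 1 Ψ ((x, gradient u x), y) :=
    (contDiff_fst.snd.contDiffAt).add (ContDiffAt.comp
      (g := fun z : EuclideanSpace ℝ (Fin n) × EuclideanSpace ℝ (Fin n) => gradX c z.1 z.2)
      ((x, gradient u x), y) hcd ((contDiff_fst.fst.prodMk contDiff_snd).contDiffAt))
  have hΨ := hΨc.hasStrictFDerivAt (by norm_num)
  have hinr : (fderiv ℝ Ψ ((x, gradient u x), y)).comp (ContinuousLinearMap.inr ℝ _ _) =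
      mixedHessian c x y := by
    have := (hΨ.hasFDerivAt.comp y (hasFDerivAt_prodMk_right (x, gradient u x) y)).fderiv
    rw [← this, mixedHessian]
    exact fderiv_const_add (gradient u x)
  have hinv : ((fderiv ℝ Ψ ((x, gradient u x), y)).comp
      (ContinuousLinearMap.inr ℝ _ _)).IsInvertible := by
    rw [hinr]
    exact ⟨(mixedHessian c x y).toContinuousLinearEquivOfDetNeZero hdet,
      ContinuousLinearMap.coe_toContinuousLinearEquivOfDetNeZero _ _⟩
  have hΨ0 : Ψ ((x, gradient u x), y) = 0 := by simp [Ψ, hgrad]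
  have hsol := hΨ.eventually_apply_implicitFunctionOfProdDomain hinv
  have hten := hΨ.tendsto_implicitFunctionOfProdDomain hinv
  have hder := (hΨ.hasStrictFDerivAt_implicitFunctionOfProdDomain hinv).hasFDerivAt
  set ψ := hΨ.implicitFunctionOfProdDomain hinv with hψ
  have hu' : DifferentiableWithinAt ℝ (gradient u) (cMapDomain X Y c u) x :=
    hu.mono fun w hw => ⟨hw.1, hw.2.1⟩
  have hpair : DifferentiableWithinAt ℝ (fun w => (w, gradient u w)) (cMapDomain X Y c u) x :=
    differentiableWithinAt_id.prodMk hu'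
  have hcont : Tendsto (fun w => (w, gradient u w)) (𝓝[cMapDomain X Y c u] x)
      (𝓝 (x, gradient u x)) := hpair.continuousWithinAt
  have hcomp : DifferentiableWithinAt ℝ (fun w => ψ (w, gradient u w)) (cMapDomain X Y c u) x :=
    DifferentiableAt.comp_differentiableWithinAt (g := ψ) x hder.differentiableAt hpair
  have hev : ∀ᶠ w in 𝓝[cMapDomain X Y c u] x, cMap c Y u w = ψ (w, gradient u w) := by
    filter_upwards [self_mem_nhdsWithin, hcont.eventually hsol,
      hcont.eventually (hten.eventually (hY.mem_nhds hyY))] with w hw h1 h2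
    refine cMap_eq hC1 hw h2 ?_
    rw [hΨ0] at h1
    exact eq_neg_of_add_eq_zero_left h1
  exact hcomp.congr_of_eventuallyEq_of_mem hev hx

end Cost

/-! ### Couplings carried by a graph -/

section Graph

open Filter Topology ProbabilityTheory

theorem ae_fst_of_ae {α β : Type*} [MeasurableSpace α] [MeasurableSpace β] [StandardBorelSpace β]
    [Nonempty β] {π : Measure (α × β)} [IsFiniteMeasure π] {p : α → Prop}
    (h : ∀ᵐ z ∂π, p z.1) : ∀ᵐ x ∂π.fst, p x := by
  rw [← π.disintegrate π.condKernel] at h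
  filter_upwards [Measure.ae_ae_of_ae_compProd h] with x hx
  exact hx.exists.choose_spec

/-- A function whose graph carries `π` is almost everywhere measurable: it agrees with the
barycenter of the conditional distributions of `π`. -/
theorem aemeasurable_of_ae_graph {α E : Type*} [MeasurableSpace α] [NormedAddCommGroup E]
    [NormedSpace ℝ E] [CompleteSpace E] [SecondCountableTopology E] [MeasurableSpace E]
    [BorelSpace E] {π : Measure (α × E)} [IsFiniteMeasure π] {T : α → E}
    (h : ∀ᵐ z ∂π, T z.1 = z.2) : AEMeasurable T π.fst := by
  rw [← π.disintegrate π.condKernel] at h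
  have hid : StronglyMeasurable (id : E → E) := stronglyMeasurable_id
  refine ⟨fun x => ∫ y, id y ∂π.condKernel x, (hid.integral_kernel).measurable, ?_⟩
  filter_upwards [Measure.ae_ae_of_ae_compProd h] with x hx
  have : ∫ y, id y ∂π.condKernel x = ∫ _y, T x ∂π.condKernel x :=
    integral_congr_ae (by filter_upwards [hx] with y hy using hy.symm)
  rw [this]
  simp

theorem map_fst_eq_snd_of_ae_graph {α β : Type*} [MeasurableSpace α] [MeasurableSpace β]
    {π : Measure (α × β)} {T : α → β} (hT : AEMeasurable T π.fst)
    (h : ∀ᵐ z ∂π, T z.1 = z.2) : π.fst.map T = π.snd := by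
  rw [Measure.fst, AEMeasurable.map_map_of_aemeasurable hT measurable_fst.aemeasurable,
    Measure.snd]
  exact Measure.map_congr h

end Graph

/-! ### Optimality and uniqueness of `T_u` -/

section Optimality

open Filter Topology

variable {n : ℕ} {X Y : Set (EuclideanSpace ℝ (Fin n))}
  {c : EuclideanSpace ℝ (Fin n) × EuclideanSpace ℝ (Fin n) → ℝ}
  {u φ : EuclideanSpace ℝ (Fin n) → ℝ} {M B B' : ℝ}
  {μ ν : Measure (EuclideanSpace ℝ (Fin n))}

/-- Duality for transport maps: the cost of `S` exceeds `∫ φ dν - ∫ u dμ` by the integral of the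
nonnegative function `u x + c (x, S x) - φ (S x)`. -/
theorem integral_duality_gap [IsProbabilityMeasure μ]
    (hX : IsOpen X) (hY : IsOpen Y) (hc : ContinuousOn c (X ×ˢ Y))
    (hcM : ∀ z ∈ X ×ˢ Y, |c z| ≤ M)
    (hu : ContinuousOn u X) (hφ : ContinuousOn φ Y) (huB : ∀ x, |u x| ≤ B)
    (hφB : ∀ y, |φ y| ≤ B') (hμ : ∀ᵐ x ∂μ, x ∈ X)
    {S : EuclideanSpace ℝ (Fin n) → EuclideanSpace ℝ (Fin n)} (hS : IsTransportMap Y μ ν S) :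
    Integrable (fun x => u x + c (x, S x) - φ (S x)) μ ∧
      ∫ x, (u x + c (x, S x) - φ (S x)) ∂μ = ∫ x, u x ∂μ + ∫ x, c (x, S x) ∂μ - ∫ y, φ y ∂ν := by
  have hνY : ∀ᵐ y ∂ν, y ∈ Y := by
    rw [← hS.map_eq]
    exact (ae_map_iff hS.aemeasurable hY.measurableSet).2 hS.mem_target
  have hui : Integrable u μ := by
    refine Integrable.of_bound ?_ B (ae_of_all _ fun x => huB x)
    rw [← Measure.restrict_eq_self_of_ae_mem hμ]
    exact hu.aestronglyMeasurable hX.measurableSet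
  have hφm : AEStronglyMeasurable φ (μ.map S) := by
    rw [hS.map_eq, ← Measure.restrict_eq_self_of_ae_mem hνY]
    exact hφ.aestronglyMeasurable hY.measurableSet
  have hφi : Integrable (fun x => φ (S x)) μ :=
    Integrable.of_bound (hφm.comp_aemeasurable hS.aemeasurable) B' (ae_of_all _ fun x => hφB _)
  have hgm : AEMeasurable (fun x => (x, S x)) μ := aemeasurable_id.prodMk hS.aemeasurable
  have hXY : ∀ᵐ z ∂μ.map (fun x => (x, S x)), z ∈ X ×ˢ Y := by
    refine (ae_map_iff hgm (hX.prod hY).measurableSet).2 ?_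
    filter_upwards [hμ, hS.mem_target] with x h1 h2 using ⟨h1, h2⟩
  have hcm : AEStronglyMeasurable c (μ.map fun x => (x, S x)) := by
    rw [← Measure.restrict_eq_self_of_ae_mem hXY]
    exact hc.aestronglyMeasurable (hX.prod hY).measurableSet
  have hci : Integrable (fun x => c (x, S x)) μ := by
    refine Integrable.of_bound (hcm.comp_aemeasurable hgm) M ?_
    filter_upwards [hμ, hS.mem_target] with x h1 h2 using hcM _ ⟨h1, h2⟩
  refine ⟨(hui.add hci).sub hφi, ?_⟩
  rw [← hS.map_eq, integral_map hS.aemeasurable hφm, ← integral_add hui hci]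
  exact integral_sub (hui.add hci) hφi

/-- A coupling carried by the contact set of a conjugate pair, with absolutely continuous first
marginal, is carried by the graph of `T_u`, and `T_u` is the unique optimal transport map. -/
theorem IsConjugatePair.isOptimalMap_cMap (h : IsConjugatePair X Y c u φ) (hX : IsOpen X)
    (hY : IsOpen Y) (hC1 : CondC1 X Y c) (hc : ContinuousOn c (X ×ˢ Y))
    (hcM : HasTaylorBound X Y c M) (hφ : ContinuousOn φ Y) (huB : ∀ x, |u x| ≤ B)
    (hφB : ∀ y, |φ y| ≤ B')
    {π : Measure (EuclideanSpace ℝ (Fin n) × EuclideanSpace ℝ (Fin n))} [IsProbabilityMeasure π]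
    (hac : π.fst ≪ volume)
    (hcontact : ∀ᵐ z ∂π, z.1 ∈ X ∧ z.2 ∈ Y ∧ u z.1 + c z = φ z.2) :
    (∀ᵐ z ∂π, cMap c Y u z.1 = z.2) ∧ (∀ᵐ x ∂π.fst, x ∈ cMapDomain X Y c u) ∧
      IsOptimalMap Y c π.fst π.snd (cMap c Y u) ∧
      ∀ S, IsOptimalMap Y c π.fst π.snd S → S =ᵐ[π.fst] cMap c Y u := by
  have hdiff : ∀ᵐ x ∂π.fst, x ∈ X → DifferentiableAt ℝ u x :=
    hac.ae_le (h.ae_differentiableAt hcM hX)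
  have hkey : ∀ᵐ z ∂π, z.1 ∈ cMapDomain X Y c u ∧ cMap c Y u z.1 = z.2 := by
    filter_upwards [ae_of_ae_map measurable_fst.aemeasurable hdiff, hcontact] with z hz hz'
    exact h.mem_cMapDomain_and_cMap_eq hcM hX hC1 hz'.1 hz'.2.1 (hz hz'.1) hz'.2.2
  have hgraph : ∀ᵐ z ∂π, cMap c Y u z.1 = z.2 := hkey.mono fun z hz => hz.2
  have hdom : ∀ᵐ x ∂π.fst, x ∈ cMapDomain X Y c u := ae_fst_of_ae (hkey.mono fun z hz => hz.1)
  have hTm : AEMeasurable (cMap c Y u) π.fst := aemeasurable_of_ae_graph hgraph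
  have hT : IsTransportMap Y π.fst π.snd (cMap c Y u) :=
    ⟨hTm, hdom.mono fun x hx => (cMap_spec hx).1, map_fst_eq_snd_of_ae_graph hTm hgraph⟩
  have hμX : ∀ᵐ x ∂π.fst, x ∈ X := hdom.mono fun x hx => hx.1
  have hT0 : ∀ᵐ x ∂π.fst, u x + c (x, cMap c Y u x) - φ (cMap c Y u x) = 0 := by
    refine ae_fst_of_ae ?_
    filter_upwards [hgraph, hcontact] with z hz hz'
    rw [hz, sub_eq_zero]
    exact hz'.2.2
  have gap := fun S (hS : IsTransportMap Y π.fst π.snd S) =>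
    integral_duality_gap hX hY hc hcM.abs_le (h.continuousOn_left hcM hX) hφ huB hφB hμX hS
  have hgapT := (gap _ hT).2
  rw [integral_congr_ae hT0, integral_zero] at hgapT
  have hnonneg : ∀ S, IsTransportMap Y π.fst π.snd S →
      0 ≤ᵐ[π.fst] fun x => u x + c (x, S x) - φ (S x) := by
    intro S hS
    filter_upwards [hμX, hS.mem_target] with x h1 h2
    have := h.le x h1 (S x) h2
    simp only [Pi.zero_apply]
    linarith
  refine ⟨hgraph, hdom, ⟨hT, fun S hS => ?_⟩, fun S hS => ?_⟩
  · have h1 := (gap S hS).2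
    have h2 := integral_nonneg_of_ae (hnonneg S hS)
    linarith
  · have h1 := (gap S hS.1).2
    have h2 := integral_nonneg_of_ae (hnonneg S hS.1)
    have h3 := hS.2 _ hT
    have h4 : ∫ x, (u x + c (x, S x) - φ (S x)) ∂π.fst = 0 := le_antisymm (by linarith) h2
    rw [integral_eq_zero_iff_of_nonneg_ae (hnonneg S hS.1) (gap S hS.1).1] at h4
    filter_upwards [h4, hdom, hS.1.mem_target] with x hx hxD hxY
    simp only [Pi.zero_apply, sub_eq_zero] at hx
    exact (h.mem_cMapDomain_and_cMap_eq hcM hX hC1 hxD.1 hxY hxD.2.1 hx).2.symm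

end Optimality

/-! ### The Jacobian equation -/

section Jacobian

open Filter Topology
open scoped NNReal ENNReal

variable {E : Type*} [NormedAddCommGroup E] [NormedSpace ℝ E] [FiniteDimensional ℝ E]
  [MeasurableSpace E] [BorelSpace E]

/-- Two functions that agree on a measurable set have the same derivatives within it at almost
all of its points. -/
theorem ae_unique_hasFDerivWithinAt (μ : Measure E) [μ.IsAddHaarMeasure] {T F : E → E} {G : Set E}
    (hG : MeasurableSet G) (hTF : EqOn T F G) (hF : ∀ x ∈ G, DifferentiableAt ℝ F x) :
    ∀ᵐ x ∂μ, x ∈ G → ∀ L, HasFDerivWithinAt T L G x → L = fderiv ℝ F x := by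
  classical
  let d : E → E →L[ℝ] E := fun x =>
    if h : ∃ L, HasFDerivWithinAt T L G x ∧ L ≠ fderiv ℝ F x then h.choose - fderiv ℝ F x else 0
  have happ : ApproximatesLinearOn (fun x => T x - F x) (0 : E →L[ℝ] E) G 0 := fun x hx y hy => by
    simp [hTF hx, hTF hy]
  have hd : ∀ x ∈ G, HasFDerivWithinAt (fun x => T x - F x) (d x) G x := by
    intro x hx
    by_cases h : ∃ L, HasFDerivWithinAt T L G x ∧ L ≠ fderiv ℝ F x
    · simp only [d, dif_pos h]
      exact h.choose_spec.1.sub (hF x hx).hasFDerivAt.hasFDerivWithinAt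
    · simp only [d, dif_neg h]
      exact (hasFDerivWithinAt_const (0 : E) x G).congr (fun y hy => by simp [hTF hy])
        (by simp [hTF hx])
  have := (ae_restrict_iff' hG).1 (happ.norm_fderiv_sub_le μ hG d hd)
  filter_upwards [this] with x hx hxG L hL
  by_contra hne
  have h : ∃ L, HasFDerivWithinAt T L G x ∧ L ≠ fderiv ℝ F x := ⟨L, hL, hne⟩
  have h0 := hx hxG
  simp only [d, dif_pos h, sub_zero, nonpos_iff_eq_zero, nnnorm_eq_zero] at h0
  exact h.choose_spec.2 (sub_eq_zero.1 h0)

/-- The Jacobian equation on a set where the transport map is Lipschitz: extend the map to a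
Lipschitz map of the whole space, which is differentiable almost everywhere, and apply the change
of variables formula where both agree. -/
theorem ae_jacobian_of_lipschitzOnWith (μ : Measure E) [μ.IsAddHaarMeasure] {f g : E → ℝ≥0∞}
    (hf : Measurable f) (hg : Measurable g) {T T' : E → E} (hT' : Measurable T')
    (hTm : AEMeasurable T (μ.withDensity f))
    (hmap : (μ.withDensity f).map T = μ.withDensity g) {G₀ : Set E} (hG₀ : MeasurableSet G₀)
    (hG₀' : ∀ᵐ x ∂μ.withDensity f, x ∈ G₀) (hTT' : EqOn T T' G₀) (hinj : InjOn T G₀)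
    {P : Set E} (hP : P ⊆ G₀) {C : ℝ≥0} (hlip : LipschitzOnWith C T P) :
    ∀ᵐ x ∂μ, x ∈ P → ∀ L, HasFDerivWithinAt T L G₀ x →
      f x = ENNReal.ofReal |L.det| * g (T x) := by
  obtain ⟨F, hF, hFT⟩ := hlip.extend_finite_dimension
  set G : Set E := {x | x ∈ G₀ ∧ F x = T' x ∧ DifferentiableAt ℝ F x} with hGdef
  have hG : MeasurableSet G :=
    hG₀.inter ((measurableSet_eq_fun hF.continuous.measurable hT').inter
      (measurableSet_of_differentiableAt ℝ F))
  have hGsub : G ⊆ G₀ := fun x hx => hx.1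
  have hTF : EqOn T F G := fun x hx => by rw [hTT' hx.1, hx.2.1]
  have hFinj : InjOn F G := (hinj.mono hGsub).congr hTF
  have hFd : ∀ x ∈ G, HasFDerivWithinAt F (fderiv ℝ F x) G x := fun x hx =>
    hx.2.2.hasFDerivAt.hasFDerivWithinAt
  have hjac : f =ᵐ[μ.restrict G] fun x => ENNReal.ofReal |(fderiv ℝ F x).det| * g (F x) := by
    have hm : Measurable fun x => ENNReal.ofReal |(fderiv ℝ F x).det| * g (F x) := by
      have h1 : Measurable fun x => (fderiv ℝ F x).det :=
        ContinuousLinearMap.continuous_det.measurable.comp (measurable_fderiv ℝ F)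
      have h2 : Measurable fun x => |(fderiv ℝ F x).det| := continuous_abs.measurable.comp h1
      exact h2.ennreal_ofReal.mul (hg.comp hF.continuous.measurable)
    refine ae_eq_of_forall_setLIntegral_eq_of_sigmaFinite hf hm fun s hs _ => ?_
    rw [Measure.restrict_restrict hs]
    have hB : MeasurableSet (s ∩ G) := hs.inter hG
    have hFd' : ∀ x ∈ s ∩ G, HasFDerivWithinAt F (fderiv ℝ F x) (s ∩ G) x := fun x hx =>
      (hFd x hx.2).mono inter_subset_right
    have hFinj' : InjOn F (s ∩ G) := hFinj.mono inter_subset_right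
    have himg : MeasurableSet (F '' (s ∩ G)) := measurable_image_of_fderivWithin hB hFd' hFinj'
    rw [← lintegral_image_eq_lintegral_abs_det_fderiv_mul μ hB hFd' hFinj' g,
      ← withDensity_apply g himg, ← hmap, Measure.map_apply_of_aemeasurable hTm himg,
      ← withDensity_apply f hB]
    refine measure_congr ?_
    filter_upwards [hG₀'] with x hx
    refine propext ⟨fun hxB => ⟨x, hxB, (hTF hxB.2).symm⟩, ?_⟩
    rintro ⟨b, hb, hbx⟩
    rw [← hTF hb.2] at hbx
    exact hinj (hGsub hb.2) hx hbx ▸ hb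
  filter_upwards [(ae_restrict_iff' hG).1 hjac,
    ae_unique_hasFDerivWithinAt μ hG hTF (fun x hx => hx.2.2), hF.ae_differentiableAt (μ := μ)]
    with x h1 h2 h3 hxP L hL
  have hxG : x ∈ G := ⟨hP hxP, by rw [← hFT hxP, hTT' (hP hxP)], h3⟩
  rw [h2 hxG L (hL.mono hGsub), hTF hxG]
  exact h1 hxG

/-- The Jacobian equation for an essentially injective transport map between two densities, at
almost every point where the map has a derivative relative to a set of full measure. That set
decomposes into countably many pieces on which the map is Lipschitz. -/
theorem ae_jacobian_of_map_withDensity (μ : Measure E) [μ.IsAddHaarMeasure] {f g : E → ℝ≥0∞}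
    (hf : Measurable f) (hg : Measurable g) {T S : E → E}
    (hTm : AEMeasurable T (μ.withDensity f))
    (hmap : (μ.withDensity f).map T = μ.withDensity g)
    (hST : ∀ᵐ x ∂μ.withDensity f, S (T x) = x) {D : Set E}
    (hD : ∀ᵐ x ∂μ.withDensity f, x ∈ D) :
    ∀ᵐ x ∂μ.withDensity f, ∀ L, HasFDerivWithinAt T L D x →
      f x = ENNReal.ofReal |L.det| * g (T x) := by
  obtain ⟨t, htsub, htm, ht0⟩ := exists_measurable_superset_of_null
    (ae_iff.1 ((hST.and hD).and hTm.ae_eq_mk))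
  have hgood : ∀ x ∈ tᶜ, (S (T x) = x ∧ x ∈ D) ∧ T x = hTm.mk T x := fun x hx => by
    by_contra hcon
    exact hx (htsub hcon)
  have hae : ∀ᵐ x ∂μ.withDensity f, x ∈ tᶜ := measure_eq_zero_iff_ae_notMem.1 ht0
  have hinj : InjOn T tᶜ := fun x hx y hy hxy => by
    rw [← (hgood x hx).1.1, ← (hgood y hy).1.1, hxy]
  obtain ⟨s, A, -, -, hcov, happ, -⟩ := exists_partition_approximatesLinearOn_of_hasFDerivWithinAt T
    {x | x ∈ tᶜ ∧ DifferentiableWithinAt ℝ T tᶜ x} (fderivWithin ℝ T tᶜ)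
    (fun x hx => hx.2.hasFDerivWithinAt.mono fun y hy => hy.1) (fun _ => 1) (fun _ => one_ne_zero)
  have hpiece : ∀ k, ∀ᵐ x ∂μ.withDensity f,
      x ∈ {x | x ∈ tᶜ ∧ DifferentiableWithinAt ℝ T tᶜ x} ∩ s k →
      ∀ L, HasFDerivWithinAt T L tᶜ x → f x = ENNReal.ofReal |L.det| * g (T x) := fun k =>
    (withDensity_absolutelyContinuous μ f).ae_le (ae_jacobian_of_lipschitzOnWith μ hf hg
      hTm.measurable_mk hTm hmap htm.compl hae (fun x hx => (hgood x hx).2) hinj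
      (fun x hx => hx.1.1) (lipschitzOnWith_iff_restrict.2 (happ k).lipschitz))
  filter_upwards [hae, ae_all_iff.2 hpiece] with x hx hxk L hL
  have hL' : HasFDerivWithinAt T L tᶜ x := hL.mono fun y hy => (hgood y hy).1.2
  obtain ⟨k, hk⟩ := mem_iUnion.1 (hcov ⟨hx, hL'.differentiableWithinAt⟩)
  exact hxk k ⟨⟨hx, hL'.differentiableWithinAt⟩, hk⟩ L hL'

theorem ae_abs_det_eq_of_map_densityMeasure {n : ℕ} {X Y : Set (EuclideanSpace ℝ (Fin n))}
    {f g : EuclideanSpace ℝ (Fin n) → ℝ} (hf : IsProbDensityOn X f) (hg : IsProbDensityOn Y g)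
    {T S : EuclideanSpace ℝ (Fin n) → EuclideanSpace ℝ (Fin n)}
    (hTm : AEMeasurable T (densityMeasure f))
    (hmap : (densityMeasure f).map T = densityMeasure g)
    (hST : ∀ᵐ x ∂densityMeasure f, S (T x) = x) {D : Set (EuclideanSpace ℝ (Fin n))}
    (hD : ∀ᵐ x ∂densityMeasure f, x ∈ D) :
    ∀ᵐ x ∂densityMeasure f, ∀ L : EuclideanSpace ℝ (Fin n) →L[ℝ] EuclideanSpace ℝ (Fin n),
      HasFDerivWithinAt T L D x → |L.det| = f x / g (T x) := by
  have hfm : AEMeasurable fun x => ENNReal.ofReal (f x) :=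
    hf.integrable.aestronglyMeasurable.aemeasurable.ennreal_ofReal
  have hgm : AEMeasurable fun x => ENNReal.ofReal (g x) :=
    hg.integrable.aestronglyMeasurable.aemeasurable.ennreal_ofReal
  have hfd : densityMeasure f = volume.withDensity (hfm.mk _) := withDensity_congr_ae hfm.ae_eq_mk
  have hgd : densityMeasure g = volume.withDensity (hgm.mk _) := withDensity_congr_ae hgm.ae_eq_mk
  have hfac : densityMeasure f ≪ volume := withDensity_absolutelyContinuous _ _
  have hgac : densityMeasure g ≪ volume := withDensity_absolutelyContinuous _ _
  have hgT : ∀ᵐ x ∂densityMeasure f,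
      ENNReal.ofReal (g (T x)) = hgm.mk _ (T x) ∧ hgm.mk _ (T x) ≠ 0 := by
    refine ae_of_ae_map hTm (p := fun y => ENNReal.ofReal (g y) = hgm.mk _ y ∧ hgm.mk _ y ≠ 0) ?_
    rw [hmap]
    refine Eventually.and (hgac.ae_le hgm.ae_eq_mk) ?_
    rw [hgd, ae_withDensity_iff hgm.measurable_mk]
    exact ae_of_all _ fun y hy => hy
  have hmain : ∀ᵐ x ∂densityMeasure f, ∀ L, HasFDerivWithinAt T L D x →
      hfm.mk _ x = ENNReal.ofReal |L.det| * hgm.mk _ (T x) := by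
    rw [hfd] at hTm hST hD hmap ⊢
    rw [hgd] at hmap
    exact ae_jacobian_of_map_withDensity volume hfm.measurable_mk hgm.measurable_mk hTm hmap hST hD
  filter_upwards [hgT, hmain, hfac.ae_le hfm.ae_eq_mk] with x hx h1 h2 L hL
  have h3 := h1 L hL
  rw [← h2, ← hx.1, ← ENNReal.ofReal_mul (abs_nonneg _),
    ENNReal.ofReal_eq_ofReal_iff (hf.nonneg x)
      (mul_nonneg (abs_nonneg _) (hg.nonneg _))] at h3
  have hpos : g (T x) ≠ 0 := fun h0 => hx.2 (by rw [← hx.1, h0, ENNReal.ofReal_zero])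
  rw [h3, mul_div_cancel_right₀ _ hpos]

end Jacobian

/-! ### `c`-convexity, densities and the conclusion -/

section Assembly

open Filter Topology

variable {n : ℕ} {X Y : Set (EuclideanSpace ℝ (Fin n))}
  {c : EuclideanSpace ℝ (Fin n) × EuclideanSpace ℝ (Fin n) → ℝ}
  {u φ : EuclideanSpace ℝ (Fin n) → ℝ}

theorem IsConjugatePair.cTransform_eq (h : IsConjugatePair X Y c u φ)
    {y : EuclideanSpace ℝ (Fin n)} (hy : y ∈ Y) :
    cTransform X c (fun x => (u x : EReal)) y = φ y := by
  refine le_antisymm ?_ (le_iInf₂ fun x hx => ?_)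
  · refine EReal.le_of_forall_lt_iff_le.1 fun a ha => ?_
    obtain ⟨x, hx, hxa⟩ := h.exists_right y hy (a - φ y) (sub_pos.2 (EReal.coe_lt_coe_iff.1 ha))
    refine (iInf₂_le x hx).trans ?_
    rw [← EReal.coe_add, EReal.coe_le_coe_iff]
    linarith
  · rw [← EReal.coe_add, EReal.coe_le_coe_iff]
    exact h.le x hx y hy

theorem IsConjugatePair.isCConvex (h : IsConjugatePair X Y c u φ) :
    IsCConvex X Y c (fun x => (u x : EReal)) := by
  refine ⟨fun x _ => EReal.coe_ne_bot _, fun x hx => ?_⟩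
  refine le_antisymm ?_ (iSup₂_le fun y hy => ?_)
  · refine EReal.ge_of_forall_gt_iff_ge.1 fun a ha => ?_
    obtain ⟨y, hy, hya⟩ := h.exists_left x hx (u x - a) (sub_pos.2 (EReal.coe_lt_coe_iff.1 ha))
    refine le_trans ?_ (le_iSup₂ y hy)
    rw [h.cTransform_eq hy, ← EReal.coe_sub, EReal.coe_le_coe_iff]
    linarith
  · rw [h.cTransform_eq hy, ← EReal.coe_sub, EReal.coe_le_coe_iff]
    linarith [h.le x hx y hy]

theorem IsProbDensityOn.isProbabilityMeasure {f : EuclideanSpace ℝ (Fin n) → ℝ}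
    (hf : IsProbDensityOn X f) : IsProbabilityMeasure (densityMeasure f) := by
  refine ⟨?_⟩
  rw [densityMeasure, withDensity_apply _ MeasurableSet.univ, Measure.restrict_univ,
    ← ofReal_integral_eq_lintegral_ofReal hf.integrable (ae_of_all _ hf.nonneg),
    hf.integral_eq_one, ENNReal.ofReal_one]

theorem IsProbDensityOn.ae_mem {f : EuclideanSpace ℝ (Fin n) → ℝ}
    (hf : IsProbDensityOn X f) : ∀ᵐ x ∂densityMeasure f, x ∈ X := by
  rw [densityMeasure, ae_withDensity_iff'
    hf.integrable.aestronglyMeasurable.aemeasurable.ennreal_ofReal]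
  refine ae_of_all _ fun x hx => ?_
  by_contra hcon
  exact hx (by rw [hf.eq_zero x hcon, ENNReal.ofReal_zero])

end Assembly

theorem mainTheorem5 (n : ℕ) (X Y : Set (EuclideanSpace ℝ (Fin n)))
    (hX : IsOpen X) (hY : IsOpen Y)
    (c : EuclideanSpace ℝ (Fin n) × EuclideanSpace ℝ (Fin n) → ℝ)
    (hC0 : CondC0 X Y c) (hC1 : CondC1 X Y c)
    (f g : EuclideanSpace ℝ (Fin n) → ℝ)
    (hf : IsProbDensityOn X f) (hg : IsProbDensityOn Y g) :
    ∃ u : EuclideanSpace ℝ (Fin n) → ℝ,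
      IsCConvex X Y c (fun x => (u x : EReal)) ∧
      (∀ᵐ x ∂densityMeasure f, x ∈ cMapDomain X Y c u) ∧
      -- `T_u` is the unique optimal transport map from `f` to `g`
      IsOptimalMap Y c (densityMeasure f) (densityMeasure g) (cMap c Y u) ∧
      (∀ S, IsOptimalMap Y c (densityMeasure f) (densityMeasure g) S →
        S =ᵐ[densityMeasure f] cMap c Y u) ∧
      (CondC2 X Y c →
        -- `T_u` is injective `f dx`-a.e.
        (∃ A : Set (EuclideanSpace ℝ (Fin n)),
          (∀ᵐ x ∂densityMeasure f, x ∈ A) ∧ InjOn (cMap c Y u) A) ∧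
        -- `T_u` is differentiable wherever `D_{xy} c` is nondegenerate on its graph
        (∀ᵐ x ∂densityMeasure f, (mixedHessian c x (cMap c Y u x)).det ≠ 0 →
          DifferentiableWithinAt ℝ (cMap c Y u) (cMapDomain X Y c u) x) ∧
        -- the Jacobian equation, wherever `T_u` has a derivative
        (∀ᵐ x ∂densityMeasure f,
          ∀ L : EuclideanSpace ℝ (Fin n) →L[ℝ] EuclideanSpace ℝ (Fin n),
            HasFDerivWithinAt (cMap c Y u) L (cMapDomain X Y c u) x →
              |L.det| = f x / g (cMap c Y u x)) ∧
        -- the inverse of `T_u` is the unique optimal transport map from `g` to `f`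
        (∃ S : EuclideanSpace ℝ (Fin n) → EuclideanSpace ℝ (Fin n),
          IsOptimalMap X (fun z => c (z.2, z.1)) (densityMeasure g) (densityMeasure f) S ∧
          (∀ S', IsOptimalMap X (fun z => c (z.2, z.1)) (densityMeasure g)
            (densityMeasure f) S' → S' =ᵐ[densityMeasure g] S) ∧
          (∀ᵐ x ∂densityMeasure f, S (cMap c Y u x) = x) ∧
          (∀ᵐ y ∂densityMeasure g, cMap c Y u (S y) = y))) := by
  have hfp := hf.isProbabilityMeasure
  have hgp := hg.isProbabilityMeasure
  have hfac : densityMeasure f ≪ volume := withDensity_absolutelyContinuous _ _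
  have hgac : densityMeasure g ≪ volume := withDensity_absolutelyContinuous _ _
  obtain ⟨M, hM⟩ := hC0.exists_hasTaylorBound hX hY
  obtain ⟨M', hM'⟩ := hC0.swap.exists_hasTaylorBound hY hX
  obtain ⟨u, φ, π, hπ, hπ1, hπ2, hpair, ⟨B, hB⟩, ⟨B', hB'⟩, hcontact⟩ :=
    exists_coupling_potentials hX hY hC0.1.continuousOn hM.abs_le hf.ae_mem hg.ae_mem
  have hu : ContinuousOn u X := hpair.continuousOn_left hM hX
  have hφ : ContinuousOn φ Y := by
    simpa only [neg_neg] using (hpair.swap.continuousOn_left hM' hY).fun_neg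
  obtain ⟨hgraph, hdom, hopt, huniq⟩ := hpair.isOptimalMap_cMap hX hY hC1 hC0.1.continuousOn hM hφ
    hB hB' (hπ1 ▸ hfac) hcontact
  rw [hπ1] at hdom
  rw [hπ1, hπ2] at hopt huniq
  refine ⟨u, hpair.isCConvex, hdom, hopt, huniq, fun hC2 => ?_⟩
  -- The swapped coupling is carried by the contact set of the swapped pair, so that the same
  -- argument produces the optimal map from `g` to `f`.
  have hπs1 : (π.map Prod.swap).fst = densityMeasure g := by rw [Measure.fst_map_swap, hπ2]
  have hπs2 : (π.map Prod.swap).snd = densityMeasure f := by rw [Measure.snd_map_swap, hπ1]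
  have hcontact' : ∀ᵐ z ∂π.map Prod.swap, z.1 ∈ Y ∧ z.2 ∈ X ∧
      (fun y => -φ y) z.1 + (fun z => c (z.2, z.1)) z = (fun x => -u x) z.2 := by
    refine MeasurableEquiv.prodComm.measurableEmbedding.ae_map_iff.2 ?_
    filter_upwards [hcontact] with z hz
    refine ⟨hz.2.1, hz.1, ?_⟩
    change -φ z.2 + c z = -u z.1
    linarith [hz.2.2]
  have hπs : IsProbabilityMeasure (π.map Prod.swap) :=
    Measure.isProbabilityMeasure_map measurable_swap.aemeasurable
  obtain ⟨hgraph', -, hopt', huniq'⟩ := hpair.swap.isOptimalMap_cMap hY hX hC2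
    hC0.swap.1.continuousOn hM' hu.neg (fun y => (abs_neg (φ y)).trans_le (hB' y))
    (fun x => (abs_neg (u x)).trans_le (hB x)) (hπs1 ▸ hgac) hcontact'
  rw [hπs1, hπs2] at hopt' huniq'
  set S := cMap (fun z => c (z.2, z.1)) X (fun y => -φ y) with hS
  have hgraph'' : ∀ᵐ z ∂π, S z.2 = z.1 :=
    ae_of_ae_map (f := Prod.swap) measurable_swap.aemeasurable hgraph'
  have hST : ∀ᵐ x ∂densityMeasure f, S (cMap c Y u x) = x := by
    rw [← hπ1]
    refine ae_fst_of_ae ?_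
    filter_upwards [hgraph, hgraph''] with z h1 h2
    rw [h1, h2]
  have hTS : ∀ᵐ y ∂densityMeasure g, cMap c Y u (S y) = y := by
    rw [← hπs1]
    refine ae_fst_of_ae ?_
    refine MeasurableEquiv.prodComm.measurableEmbedding.ae_map_iff.2 ?_
    filter_upwards [hgraph, hgraph''] with z h1 h2
    change cMap c Y u (S z.2) = z.2
    rw [h2, h1]
  refine ⟨⟨{x | S (cMap c Y u x) = x}, hST, fun x hx x' hx' hxx' => ?_⟩, ?_,
    ae_abs_det_eq_of_map_densityMeasure hf hg hopt.1.aemeasurable hopt.1.map_eq hST hdom,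
    S, hopt', huniq', hST, hTS⟩
  · rw [← show S (cMap c Y u x) = x from hx, ← show S (cMap c Y u x') = x' from hx', hxx']
  · filter_upwards [hdom, hfac.ae_le (hpair.ae_differentiableWithinAt_gradient hM hX)]
      with x hx hgrad hdet
    exact differentiableWithinAt_cMap hC0 hC1 hX hY hx (hgrad hx.1 hx.2.1) hdet
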